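/- **Setting.** A pairwise Markov random field (MRF) consists of a simple graph $G=(V,E)$ with $V=\{1,\dots,n\}$, $n\ge 1$, a finite non-empty alphabet $\Sigma$, and potentials $\phi_v:\Sigma\to\mathbb R_{\ge 0}$ $(v\in V)$ and $\psi_{uv}:\Sigma^2\to\mathbb R_{\ge 0}$ $(\{u,v\}\in E,\ u<v)$. Put $\mathcal H(x)=\sum_{v\in V}\phi_v(x_v)+\sum_{\{u,v\}\in E}\psi_{uv}(x_u,x_v)$ for $x\in\Sigma^n$; a MAP assignment $x^*$ is a maximizer of $\mathcal H$. Let $d_G$ be the shortest-path metric ($\infty$ between different components) and $\mathbf B(v,r)=\{u: d_G(u,v)<r\}$. The doubling dimension of $G$ is $\log_2\lambda$, where $\lambda$ is the least integer such that every ball $\mathbf B(v,r)$ is contained in a union of at most $\lambda$ balls of radius $r/2$. **Db-dim$(\varphi,K)$**, for $\varphi\in(0,1)$ and an integer $K\ge 1$, on a finite graph with metric $d$: let $\mathbf Q$ be the random variable with $\Pr[\mathbf Q=i]=\varphi(1-\varphi)^{i-1}$ for $1\le i<K$ and $\Pr[\mathbf Q=K]=(1-\varphi)^{K-1}$. Initially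 all vertices are white. While there are white vertices, choose a white vertex $u$ uniformly at random and draw an independent copy $Q$ of $\mathbf Q$; the white vertices $w$ with $d(u,w)=Q$ become blue, those with $d(u,w)<Q$ become red. The output is the set of blue vertices. **Mode** using Db-dim$(\varphi,K)$: run Db-dim$(\varphi,K)$ on the graph whose vertices are the edges of $G$, two of them adjacent when they share an endpoint, to obtain a random set $\mathcal B\subset E$. On each connected component of $(V,E\setminus\mathcal B)$ compute by exhaustive search an exact MAP assignment for the potentials of its vertices and of its edges in $E\setminus\mathcal B$ (ties broken in any way). These together form the output $\widehat{x}$. **Theorem.** For real $\rho\ge 1$ and $\varepsilon\in(0,1)$ put $\varphi=\varepsilon 2^{-\rho-3}$ and $K(\varphi,\rho)=\frac{12\rho}{\varphi}\log\frac{24\rho}{\varphi}$ (natural logarithm). Let an MRF be given whose graph $G$ on $n$ vertices has doubling dimension at most $\rho$. Then Mode using Db-dim$(\varphi,\lceil K(\varphi,\rho)\rceil)$ outputs $\widehat x$ with $$\mathbb E\left[\mathcal H(x^*)-\mathcal H(\widehat x)\right]\le\varepsilon\,\mathcal H(x^*).$$ If $|\Sigma|\ge 2$, the algorithm, implemented on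 a random-access machine with unit-cost real arithmetic and random draws (uniform draws at one step, draws of $\mathbf Q$ at $\lceil K(\varphi,\rho)\rceil$ steps), with $G$ given by adjacency lists and with $\varphi$ and $\lceil K(\varphi,\rho)\rceil$ given, always finishes within $$O\left(n\,2^{\rho}\,|\Sigma|^{K(\varphi,\rho)^{2\rho}}\right)$$ steps, with an absolute constant. Further, for a fixed finite non-empty alphabet $\Sigma$ and a sequence of instances with $n\to\infty$ whose parameters $\rho\ge1$ and $\varepsilon\in(0,1)$ (which may vary) satisfy $\rho(\rho+\log(1/\varepsilon))=o(\log\log n)$, the algorithm takes $o(n^{1+\delta})$ steps, for every $\delta>0$. -/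

import Mathlib

open Filter Asymptotics
open scoped ENNReal NNReal

noncomputable section

namespace ModeAlg

/-! ### Doubling dimension -/

/-- The open ball `{w | d(v, w) < r}` of the shortest-path metric (`d = ∞` between components). -/
def ball {V : Type*} (G : SimpleGraph V) (v : V) (r : ℝ≥0) : Set V :=
  {w | ((G.edist v w : ℕ∞) : ℝ≥0∞) < (r : ℝ≥0∞)}

/-- The least `k` such that every ball is covered by at most `k` balls of half its radius. -/
def doublingConstant {V : Type*} (G : SimpleGraph V) : ℕ :=
  sInf {k | ∀ (v : V) (r : ℝ≥0), ∃ s : Finset V, s.card ≤ k ∧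
    ball G v r ⊆ ⋃ u ∈ s, ball G u (r / 2)}

/-- The doubling dimension: the binary logarithm of the doubling constant. -/
def doublingDim {V : Type*} (G : SimpleGraph V) : ℝ :=
  Real.logb 2 (doublingConstant G)

/-! ### The randomized decomposition -/

/-- The point masses of the law of `Q` on `{1, …, K}`. -/
def stopMass (p : ℝ) (K i : ℕ) : ℝ :=
  if 1 ≤ i ∧ i < K then p * (1 - p) ^ (i - 1) else if i = K then (1 - p) ^ (K - 1) else 0

lemma stopMass_nonneg {p : ℝ} (hp : p ∈ Set.Icc (0 : ℝ) 1) (K i : ℕ) : 0 ≤ stopMass p K i := by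
  have h1 : 0 ≤ 1 - p := sub_nonneg.2 hp.2
  have h0 : 0 ≤ p := hp.1
  unfold stopMass
  split_ifs <;> positivity

lemma sum_stopMass (p : ℝ) (K : ℕ) : ∑ i ∈ Finset.range (K + 1), stopMass p K i = 1 := by
  have key : ∀ m k : ℕ, m ≤ k → ∑ i ∈ Finset.range (m + 1), stopMass p (k + 1) i
      = 1 - (1 - p) ^ m := by
    intro m
    induction m with
    | zero => intro k _; simp [stopMass]
    | succ m ih =>
      intro k hk
      rw [Finset.sum_range_succ, ih k (by omega)]
      have : stopMass p (k + 1) (m + 1) = p * (1 - p) ^ m := by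
        simp [stopMass]; intro h; omega
      rw [this]; ring
  cases K with
  | zero => simp [stopMass]
  | succ k =>
    rw [Finset.sum_range_succ, key k k le_rfl]
    simp [stopMass]

/-- The law of `Q`: `P(Q = i) = p (1 - p) ^ (i - 1)` for `1 ≤ i < K` and
`P(Q = K) = (1 - p) ^ (K - 1)`. -/
def stopLaw (p : ℝ) (hp : p ∈ Set.Icc (0 : ℝ) 1) (K : ℕ) : PMF ℕ :=
  PMF.ofFinset (fun i => ENNReal.ofReal (stopMass p K i)) (Finset.range (K + 1))
    (by
      rw [← ENNReal.ofReal_sum_of_nonneg fun i _ => stopMass_nonneg hp K i, sum_stopMass]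
      simp)
    (by
      intro i hi
      have hi' : K + 1 ≤ i := by simpa using hi
      have h1 : ¬ (1 ≤ i ∧ i < K) := by omega
      have h2 : i ≠ K := by omega
      simp [stopMass, h1, h2])

open Classical in
/-- The loop of the node decomposition, from a state with white set `W` and blue set `B` (all
other vertices are red): while `W` is nonempty, draw `u` uniformly from `W` and `q` from `Q`;
the white vertices at distance `q` from `u` turn blue, those at distance `< q` turn red, those
at distance `> q` stay white. The output is the final blue set. -/
def dbDimFrom {V : Type} (H : SimpleGraph V) (Q : PMF ℕ) (W B : Finset V) : PMF (Finset V) :=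
  if h : W.Nonempty then
    haveI : Nonempty ↥W := h.to_subtype
    (PMF.uniformOfFintype ↥W).bind fun u =>
      Q.bind fun q =>
        dbDimFrom H Q (W.filter fun w => (q : ℕ∞) < H.edist u w)
          (B ∪ W.filter fun w => H.edist u w = (q : ℕ∞))
  else PMF.pure B
termination_by W.card
decreasing_by
  apply Finset.card_lt_card
  refine Finset.ssubset_iff_subset_ne.2 ⟨Finset.filter_subset _ _, fun he => ?_⟩
  have hu := (Finset.ext_iff.1 he u).2 u.2
  simp at hu

/-- `Db-dim(p, K)` on the graph `H`: the law of the random set of removed vertices. -/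
def dbDim {V : Type} [Fintype V] (H : SimpleGraph V) (p : ℝ) (hp : p ∈ Set.Icc (0 : ℝ) 1)
    (K : ℕ) : PMF (Finset V) :=
  dbDimFrom H (stopLaw p hp K) Finset.univ ∅

/-! ### Pairwise Markov random fields -/

/-- A pairwise Markov random field on `n` vertices over the alphabet `S`, in exponential form.
`edgePot e a b` is the potential of the edge `e` when its smaller endpoint has value `a` and its
larger endpoint has value `b`. -/
structure MRF (n : ℕ) (S : Type) where
  graph : SimpleGraph (Fin n)
  nodePot : Fin n → S → ℝ
  edgePot : graph.edgeSet → S → S → ℝ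
  nodePot_nonneg : ∀ v a, 0 ≤ nodePot v a
  edgePot_nonneg : ∀ e a b, 0 ≤ edgePot e a b

namespace MRF

variable {n : ℕ} {S : Type} (M : MRF n S)

/-- The set of edges. -/
abbrev Edge : Type := M.graph.edgeSet

/-- The smaller endpoint of an edge. -/
def lo (e : M.Edge) : Fin n := e.1.inf

/-- The larger endpoint of an edge. -/
def hi (e : M.Edge) : Fin n := e.1.sup

instance : Fintype M.Edge := Fintype.ofFinite _

/-- The function `H(x)`, the sum of all node and edge potentials. -/
def energy (x : Fin n → S) : ℝ :=
  ∑ v, M.nodePot v (x v) + ∑ e : M.Edge, M.edgePot e (x (M.lo e)) (x (M.hi e))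

/-- `x` is a MAP assignment. -/
def IsMAP (x : Fin n → S) : Prop := ∀ y, M.energy y ≤ M.energy x

/-- The graph `(V, E \ B)`. -/
def cutGraph (B : Finset M.Edge) : SimpleGraph (Fin n) :=
  M.graph.deleteEdges (Subtype.val '' (B : Set M.Edge))

open Classical in
/-- The sum of the potentials of the vertices and the remaining edges of a connected component of
`(V, E \ B)`. A remaining edge lies in the component of its smaller endpoint. -/
def energyOn (B : Finset M.Edge) (c : (M.cutGraph B).ConnectedComponent) (x : Fin n → S) : ℝ :=
  ∑ v with (M.cutGraph B).connectedComponentMk v = c, M.nodePot v (x v) +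
    ∑ e : M.Edge with e ∉ B ∧ (M.cutGraph B).connectedComponentMk (M.lo e) = c,
      M.edgePot e (x (M.lo e)) (x (M.hi e))

/-- `x` restricts to an exact MAP assignment of every connected component of `(V, E \ B)`. -/
def IsComponentMAP (B : Finset M.Edge) (x : Fin n → S) : Prop :=
  ∀ (c : (M.cutGraph B).ConnectedComponent) (y : Fin n → S),
    M.energyOn B c y ≤ M.energyOn B c x

/-- `μ` is a joint law of the pair (removed edges, output assignment) of the algorithm Mode that
uses `Db-dim(p, K)` on the graph of edges as edge decomposition: the removed edges have the law of
the decomposition, and the output is an exact MAP assignment on every remaining component (no rule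
for breaking ties is fixed). -/
def IsModeLaw (p : ℝ) (hp : p ∈ Set.Icc (0 : ℝ) 1) (K : ℕ)
    (μ : PMF (Finset M.Edge × (Fin n → S))) : Prop :=
  μ.map Prod.fst = dbDim M.graph.lineGraph p hp K ∧
    ∀ z ∈ μ.support, M.IsComponentMAP z.1 z.2

end MRF

/-! ### The algorithm with a step count

Below, the algorithm is written with an explicit count of elementary steps, for a random-access
machine that adds and compares real numbers in one step. Every expression outside a call
of another counted function is a bounded number of the following elementary operations, and is
paid for by `tick`: matching on a list or putting an element in front of it; reading or
overwriting an array entry (arrays are functions, the write is `Function.update`); inserting into,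
deleting from, testing emptiness of or membership in a set of vertices or edges, or drawing a
uniformly random element of it (such a set is kept as an array of its elements together with the
array of their positions); arithmetic and comparison. A graph is given by the list of its vertices
and edges and the lists of edges at each vertex, an edge by its two endpoints. -/

/-- A value together with the number of steps spent to compute it. -/
structure Timed (α : Type) where
  val : α
  time : ℕ

instance : Monad Timed where
  pure a := ⟨a, 0⟩
  bind a f := ⟨(f a.val).val, a.time + (f a.val).time⟩

/-- Spend `k` steps. -/
def tick (k : ℕ) : Timed Unit := ⟨(), k⟩

/-- Sequential composition of randomized computations with a step count. -/
def andThen {α β : Type} (a : PMF (Timed α)) (f : α → PMF (Timed β)) : PMF (Timed β) :=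
  a.bind fun r => (f r.val).map fun r' => ⟨r'.val, r.time + r'.time⟩

section Search

variable {V : Type} [DecidableEq V]

/-- Put the vertices of a list that have not been seen into `next`, and mark them as seen. The
third step pays for unmarking the vertex after the search. -/
def scan : List V → Finset V → List V → Timed (Finset V × List V)
  | [], seen, next => do
    tick 1
    return (seen, next)
  | w :: l, seen, next => do
    tick 3
    if w ∈ seen then scan l seen next else scan l (insert w seen) (w :: next)

/-- One layer of breadth-first search: the unseen neighbours of the vertices of a list. -/
def expand (adj : V → List V) : List V → Finset V → List V → Timed (Finset V × List V)
  | [], seen, next => do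
    tick 1
    return (seen, next)
  | v :: l, seen, next => do
    tick 1
    let r ← scan (adj v) seen next
    expand adj l r.1 r.2

/-- Move the white vertices of a list from the white set to the set `painted`. -/
def paint : List V → Finset V → Finset V → Timed (Finset V × Finset V)
  | [], white, painted => do
    tick 1
    return (white, painted)
  | v :: l, white, painted => do
    tick 3
    if v ∈ white then paint l (white.erase v) (insert v painted) else paint l white painted

/-- Breadth-first search to depth `q`, starting from the current layer: the white vertices in the
layers before the last one turn red, those in the last one turn blue. The result is the new white,
blue and red sets. -/
def sweep (adj : V → List V) : ℕ → List V → Finset V → Finset V → Finset V → Finset V →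
    Timed (Finset V × Finset V × Finset V)
  | 0, layer, _, white, blue, red => do
    tick 1
    let r ← paint layer white blue
    return (r.1, r.2, red)
  | q + 1, layer, seen, white, blue, red => do
    tick 1
    let r ← paint layer white red
    let s ← expand adj layer seen []
    sweep adj q s.2 s.1 r.1 blue r.2

/-- The decomposition loop, for at most the given number of iterations. Drawing a number from the
law `Q` on `{1, …, K}` is charged `K` steps. -/
def dbDimRun (adj : V → List V) (Q : PMF ℕ) (K : ℕ) :
    ℕ → Finset V → Finset V → Finset V → PMF (Timed (Finset V))
  | 0, _, blue, _ => PMF.pure ⟨blue, 1⟩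
  | k + 1, white, blue, red =>
    if h : white.Nonempty then
      (PMF.uniformOfFinset white h).bind fun u =>
        Q.bind fun q =>
          andThen
            (PMF.pure (do
              tick (K + 4)
              sweep adj q [u] {u} white blue red))
            fun r => dbDimRun adj Q K k r.1 r.2.1 r.2.2
    else PMF.pure ⟨blue, 1⟩

/-- The vertices reached by breadth-first search from the current layer, in front of `acc`, and
the set of all vertices seen so far. -/
def explore (adj : V → List V) : ℕ → List V → Finset V → List V → Timed (Finset V × List V)
  | 0, _, seen, acc => do
    tick 1
    return (seen, acc)
  | _ + 1, [], seen, acc => do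
    tick 1
    return (seen, acc)
  | k + 1, v :: l, seen, acc => do
    tick (2 + l.length)
    let r ← expand adj (v :: l) seen []
    explore adj k r.2 r.1 ((v :: l) ++ acc)

end Search

namespace MRF

variable {n : ℕ} {S : Type} (M : MRF n S)

open Classical in
/-- The input list of the edges at a vertex. -/
def inc (v : Fin n) : List M.Edge :=
  (Finset.univ.filter fun e : M.Edge => v ∈ e.1).toList

/-- The elements of a list of edges other than `e`, in front of `acc`. -/
def copyOthers (e : M.Edge) : List M.Edge → List M.Edge → Timed (List M.Edge)
  | [], acc => do
    tick 1
    return acc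
  | f :: l, acc => do
    tick 2
    if f = e then copyOthers e l acc else copyOthers e l (f :: acc)

/-- The neighbour lists of the graph of edges, for the edges in a list. -/
def edgeAdj : List M.Edge → (M.Edge → List M.Edge) → Timed (M.Edge → List M.Edge)
  | [], tab => do
    tick 1
    return tab
  | e :: l, tab => do
    tick 2
    let a ← M.copyOthers e (M.inc (M.lo e)) []
    let b ← M.copyOthers e (M.inc (M.hi e)) a
    edgeAdj l (Function.update tab e b)

/-- The edge decomposition: set up the graph of edges and the initial white set, then run the
decomposition loop (each iteration colours at least one edge, so `|E|` iterations suffice). -/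
def decompRun (p : ℝ) (hp : p ∈ Set.Icc (0 : ℝ) 1) (K : ℕ) : PMF (Timed (Finset M.Edge)) :=
  andThen
    (PMF.pure (do
      tick (1 + 3 * Fintype.card M.Edge)
      M.edgeAdj Finset.univ.toList fun _ => []))
    fun adj => dbDimRun adj (stopLaw p hp K) K (Fintype.card M.Edge) Finset.univ ∅ ∅

/-- From a list of edges at `v`, collect the other endpoints of the edges outside `B`, and those
edges outside `B` of which `v` is the smaller endpoint. -/
def keepRow (B : Finset M.Edge) (v : Fin n) :
    List M.Edge → List (Fin n) → List M.Edge → Timed (List (Fin n) × List M.Edge)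
  | [], nb, low => do
    tick 1
    return (nb, low)
  | e :: l, nb, low => do
    tick 4
    if e ∈ B then keepRow B v l nb low
    else if M.lo e = v then keepRow B v l (M.hi e :: nb) (e :: low)
    else keepRow B v l (M.lo e :: nb) low

/-- The tables of `keepRow` for the vertices in a list. -/
def keepTable (B : Finset M.Edge) : List (Fin n) → (Fin n → List (Fin n) × List M.Edge) →
    Timed (Fin n → List (Fin n) × List M.Edge)
  | [], tab => do
    tick 1
    return tab
  | v :: l, tab => do
    tick 2
    let r ← M.keepRow B v (M.inc v) [] []
    keepTable B l (Function.update tab v r)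

/-- Add the potentials of a list of edges to `acc`. -/
def edgeScore (x : Fin n → S) : List M.Edge → ℝ → Timed ℝ
  | [], acc => do
    tick 1
    return acc
  | e :: l, acc => do
    tick 2
    edgeScore x l (acc + M.edgePot e (x (M.lo e)) (x (M.hi e)))

/-- Add the potentials of a list of vertices and of the edges in their rows of `low` to `acc`. -/
def score (low : Fin n → List M.Edge) (x : Fin n → S) : List (Fin n) → ℝ → Timed ℝ
  | [], acc => do
    tick 1
    return acc
  | v :: l, acc => do
    tick 2
    let s ← M.edgeScore x (low v) (acc + M.nodePot v (x v))
    score low x l s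

open Classical in
/-- Exhaustive search over the values at a list of vertices of the component `comp`, keeping the
best score and assignment so far. Recording a new best assignment means copying its values on
`comp`: elsewhere it never changes during the search. -/
def exhaust (letters : List S) (low : Fin n → List M.Edge) (comp : List (Fin n)) :
    List (Fin n) → (Fin n → S) → ℝ × (Fin n → S) → Timed (ℝ × (Fin n → S))
  | [], x, best => do
    tick 2
    let s ← M.score low x comp 0
    if best.1 < s then
      tick comp.length
      return (s, x)
    else
      return best
  | v :: l, x, best => do
    tick 1
    letters.foldlM
      (fun b a => do
        tick 2
        exhaust letters low comp l (Function.update x v a) b) best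

/-- Go through a list of vertices; for each one that has not been seen, find its connected
component and an exact MAP assignment of the component. The steps proportional to the size of the
component pay for copying the assignment into the record of the search and back. -/
def solve (letters : List S) (tab : Fin n → List (Fin n) × List M.Edge) :
    List (Fin n) → Finset (Fin n) → (Fin n → S) → Timed (Fin n → S)
  | [], _, x => do
    tick 1
    return x
  | v :: l, seen, x => do
    tick 3
    if v ∈ seen then solve letters tab l seen x
    else do
      let r ← explore (fun w => (tab w).1) n [v] (insert v seen) []
      tick (3 * r.2.length)
      let s ← M.score (fun w => (tab w).2) x r.2 0
      let best ← M.exhaust letters (fun w => (tab w).2) r.2 r.2 x (s, x)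
      solve letters tab l r.1 best.2

/-- The algorithm Mode with `Db-dim(p, K)` on the graph of edges, with its step count. It returns
the removed edges and the assignment. -/
def modeRun [Fintype S] [Nonempty S] (p : ℝ) (hp : p ∈ Set.Icc (0 : ℝ) 1) (K : ℕ) :
    PMF (Timed (Finset M.Edge × (Fin n → S))) :=
  andThen (M.decompRun p hp K) fun B =>
    PMF.pure (do
      tick (1 + 3 * n)
      let tab ← M.keepTable B (List.finRange n) fun _ => ([], [])
      let x ← M.solve Finset.univ.toList tab (List.finRange n) ∅ fun _ => Classical.arbitrary S
      return (B, x))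

end MRF

/-! ### The parameters -/

/-- `φ = ε 2^{-ρ-3}`. -/
def rate (ε ρ : ℝ) : ℝ := ε * (2 : ℝ) ^ (-ρ - 3)

lemma rate_mem {ε ρ : ℝ} (h0 : 0 < ε) (h1 : ε < 1) (hρ : 1 ≤ ρ) :
    rate ε ρ ∈ Set.Icc (0 : ℝ) 1 := by
  have h2 : (2 : ℝ) ^ (-ρ - 3) ≤ 1 :=
    Real.rpow_le_one_of_one_le_of_nonpos (by norm_num) (by linarith)
  have h3 : (0 : ℝ) < (2 : ℝ) ^ (-ρ - 3) := by positivity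
  exact ⟨by unfold rate; positivity, by unfold rate; nlinarith⟩

/-- `K(φ, ρ) = (12 ρ / φ) log (24 ρ / φ)`. -/
def radius (φ ρ : ℝ) : ℝ := 12 * ρ / φ * Real.log (24 * ρ / φ)

end ModeAlg

end

namespace ModeAlg

/-! Write `λ` for the doubling constant, `R` for `radius φ ρ`, `K` for its ceiling. Three facts
carry the proof.

Cut probability. Follow a white edge `e` until it is coloured. A centre at distance `j < K` either
leaves it white or colours it, and by memorylessness of the geometric law the conditional
probability of blue given coloured is at most `φ`. Only the truncation at `K` spoils this: a centre
at distance exactly `K` costs the mass of `K`, and each vertex is a centre at most once. Hence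
`dbDimFrom_mem_le`: the probability is at most `φ` plus that mass, `(1 - φ) ^ (K - 1)`, times the
size of the sphere of radius `K`. Iterated halving of balls makes this sphere polynomial in `K` with
degree of order `ρ`, and `K` is chosen so that the second term is at most `φ`
(`cut_probability_le`). So every edge is cut with probability at most `2φ ≤ ε`.

Loss. The output is optimal on each component and the potentials are nonnegative, so against any
assignment the loss is at most the value of the cut edges under that assignment (`energy_sub_le`).
Linearity of expectation concludes (`expected_loss_le`).

Time. Adjacent uncut edges are turned red by the same centre (`exists_center_of_mem_support`), so
every component lies in a ball of radius `K` of `G` and has at most `m = λ ^ (log₂ K + 1)` vertices,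
whatever the random draws. Exhaustive search on it costs `|Σ| ^ m` up to polynomial factors, which
are absorbed into the exponent (`modeRun_time_le_mul`). The slowly growing regime follows from `R ^
(2ρ) ≤ exp (36 ρ (ρ + log (1/ε)))`, which is eventually at most `√(log n)`. The counted program is
shown to have the law of Mode in `isModeLaw_modeRun`. -/

/-! ### Ball and edge counts from the doubling constant. -/

open Classical in
-- The infimum is attained because on a finite graph all vertices together serve as centres; a ball
-- of radius `0` is empty, so only `r > 0` needs an argument.
lemma doublingConstant_spec {V : Type*} [Fintype V] (G : SimpleGraph V) (v : V) (r : ℝ≥0) :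
    ∃ s : Finset V, s.card ≤ doublingConstant G ∧ ball G v r ⊆ ⋃ u ∈ s, ball G u (r / 2) := by
  have hne : {k | ∀ (v : V) (r : ℝ≥0), ∃ s : Finset V, s.card ≤ k ∧
      ball G v r ⊆ ⋃ u ∈ s, ball G u (r / 2)}.Nonempty := by
    refine ⟨Fintype.card V, fun v r => ⟨Finset.univ, le_rfl, fun w hw => ?_⟩⟩
    simp only [Finset.mem_univ, Set.iUnion_true, Set.mem_iUnion]
    refine ⟨w, ?_⟩
    have hr : 0 < r := by
      by_contra h
      have : r = 0 := by simpa using h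
      simp [ball, this] at hw
    simpa [ball] using hr.ne'
  exact Nat.sInf_mem hne v r

lemma one_le_doublingConstant {V : Type*} [Fintype V] [Nonempty V] (G : SimpleGraph V) :
    1 ≤ doublingConstant G := by
  obtain ⟨v⟩ := ‹Nonempty V›
  obtain ⟨s, hs, hb⟩ := doublingConstant_spec G v 1
  rcases s.eq_empty_or_nonempty with rfl | h
  · have : v ∈ ball G v 1 := by simp [ball]
    simpa using hb this
  · exact h.card_pos.trans_le hs

lemma mem_ball_natCast {V : Type*} (G : SimpleGraph V) (v w : V) (m : ℕ) :
    w ∈ ball G v (m : ℝ≥0) ↔ G.edist v w < m := by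
  unfold ball
  rw [Set.mem_ofPred_eq, ENNReal.coe_natCast, ← ENat.toENNReal_coe, ENat.toENNReal_lt]

open Classical in
-- Halving `k` times leads to radius `1`, where an open ball is a single vertex since distances are
-- integers.
lemma card_edist_lt_two_pow_le {V : Type*} [Fintype V] (G : SimpleGraph V) (k : ℕ) (v : V) :
    (Finset.univ.filter fun w => G.edist v w < ((2 ^ k : ℕ) : ℕ∞)).card
      ≤ doublingConstant G ^ k := by
  induction k generalizing v with
  | zero =>
    simp only [pow_zero, Nat.cast_one, Order.lt_one_iff, SimpleGraph.edist_eq_zero_iff]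
    exact Finset.card_le_one.2 (by simp)
  | succ k ih =>
    obtain ⟨s, hs, hb⟩ := doublingConstant_spec G v ((2 ^ (k + 1) : ℕ) : ℝ≥0)
    have h2 : ((2 ^ (k + 1) : ℕ) : ℝ≥0) / 2 = ((2 ^ k : ℕ) : ℝ≥0) := by
      push_cast
      rw [pow_succ]
      field_simp
    rw [h2] at hb
    have hsub : (Finset.univ.filter fun w => G.edist v w < ((2 ^ (k + 1) : ℕ) : ℕ∞)) ⊆
        s.biUnion fun u => Finset.univ.filter fun w => G.edist u w < ((2 ^ k : ℕ) : ℕ∞) := by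
      intro w hw
      have := hb ((mem_ball_natCast G v w _).2 (by simpa using hw))
      simp only [Set.mem_iUnion, mem_ball_natCast] at this
      simpa using this
    refine (Finset.card_le_card hsub).trans ?_
    refine (Finset.card_biUnion_le_card_mul _ _ _ fun u _ => ih u).trans ?_
    rw [pow_succ']
    gcongr

open Classical in
/-- The number of vertices at distance at most `K` from a vertex. -/
lemma card_edist_le_le {V : Type*} [Fintype V] (G : SimpleGraph V) (K : ℕ) (v : V) :
    (Finset.univ.filter fun w => G.edist v w ≤ (K : ℕ∞)).card
      ≤ doublingConstant G ^ (Nat.log 2 K + 1) := by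
  refine (Finset.card_le_card fun w hw => ?_).trans (card_edist_lt_two_pow_le G _ v)
  simp only [Finset.mem_filter, Finset.mem_univ, true_and] at hw ⊢
  exact hw.trans_lt (by exact_mod_cast Nat.lt_pow_succ_log_self one_lt_two K)

open Classical in
-- An edge at `v` is determined by its other endpoint, which lies in the open ball of radius `2`.
lemma card_edges_at_le {V : Type*} [Fintype V] (G : SimpleGraph V) [Fintype G.edgeSet] (v : V) :
    (Finset.univ.filter fun e : G.edgeSet => v ∈ e.1).card ≤ doublingConstant G := by
  refine le_trans ?_ ((card_edist_lt_two_pow_le G 1 v).trans_eq (pow_one _))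
  refine Finset.card_le_card_of_injOn
    (fun e => if h : v ∈ e.1 then Sym2.Mem.other h else v) ?_ ?_
  · intro e he
    have hv : v ∈ e.1 := by simpa using he
    have hadj : G.Adj v (Sym2.Mem.other hv) := by
      rw [← SimpleGraph.mem_edgeSet, Sym2.other_spec hv]
      exact e.2
    simp only [hv, dite_true, Finset.coe_filter, Finset.mem_univ, true_and, Set.mem_ofPred_eq]
    rw [SimpleGraph.edist_eq_one_iff_adj.2 hadj]
    norm_num
  · intro e he f hf hef
    have hv : v ∈ e.1 := by simpa using he
    have hv' : v ∈ f.1 := by simpa using hf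
    simp only [hv, hv', dite_true] at hef
    apply Subtype.ext
    rw [← Sym2.other_spec hv, ← Sym2.other_spec hv', hef]

open Classical in
lemma card_edgeSet_le {V : Type*} [Fintype V] (G : SimpleGraph V) [Fintype G.edgeSet] :
    Fintype.card G.edgeSet ≤ Fintype.card V * doublingConstant G := by
  have hsub : (Finset.univ : Finset G.edgeSet) ⊆
      Finset.univ.biUnion fun v => Finset.univ.filter fun e : G.edgeSet => v ∈ e.1 := by
    intro e _
    simp only [Finset.mem_biUnion, Finset.mem_univ, true_and, Finset.mem_filter]
    exact ⟨_, Sym2.out_fst_mem e.1⟩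
  refine (Finset.card_le_card hsub).trans ?_
  exact Finset.card_biUnion_le_card_mul _ _ _ fun v _ => card_edges_at_le G v

/-! ### Distance layers, and distances in the graph of edges. -/

lemma edist_eq_succ_iff {V : Type*} (G : SimpleGraph V) (u x : V) (k : ℕ) :
    G.edist u x = ((k + 1 : ℕ) : ℕ∞) ↔
      ¬ G.edist u x ≤ k ∧ ∃ v, G.edist u v = k ∧ G.Adj v x := by
  constructor
  · intro h
    refine ⟨by rw [h]; exact_mod_cast Nat.not_succ_le_self k, ?_⟩
    -- The geodesic is taken from `x` to `u`, so that `cases` exposes the edge at `x`.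
    obtain ⟨p, hp⟩ := SimpleGraph.exists_walk_of_edist_eq_coe (G.edist_comm.trans h)
    cases p with
    | nil => simp at hp
    | @cons _ v _ hadj p =>
      refine ⟨v, ?_, hadj.symm⟩
      simp only [SimpleGraph.Walk.length_cons] at hp
      have h1 : G.edist u v ≤ k := by
        rw [SimpleGraph.edist_comm]
        exact (SimpleGraph.edist_le p).trans (by exact_mod_cast (by omega))
      refine le_antisymm h1 ?_
      have h2 : G.edist u x ≤ G.edist u v + G.edist v x := SimpleGraph.edist_triangle
      rw [h, SimpleGraph.edist_eq_one_iff_adj.2 hadj.symm] at h2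
      generalize G.edist u v = a at h1 h2
      lift a to ℕ using ne_top_of_le_ne_top (ENat.natCast_ne_top k) h1
      norm_cast at h2 ⊢
      omega
  · rintro ⟨h1, v, hv, hadj⟩
    have h2 : G.edist u x ≤ G.edist u v + G.edist v x := SimpleGraph.edist_triangle
    rw [hv, SimpleGraph.edist_eq_one_iff_adj.2 hadj] at h2
    generalize G.edist u x = a at h1 h2
    lift a to ℕ using ne_top_of_le_ne_top (by exact ENat.natCast_ne_top (k + 1)) h2
    norm_cast at h1 h2 ⊢
    omega

lemma edist_le_succ_of_adj {V : Type*} (G : SimpleGraph V) {u v w : V} {k : ℕ}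
    (h : G.edist u v ≤ k) (hadj : G.Adj v w) : G.edist u w ≤ ((k + 1 : ℕ) : ℕ∞) := by
  refine (SimpleGraph.edist_triangle (v := v)).trans ?_
  rw [SimpleGraph.edist_eq_one_iff_adj.2 hadj]
  push_cast
  gcongr

lemma edist_le_succ_of_mem_edge {V : Type*} (G : SimpleGraph V) {u v w : V} {k : ℕ}
    (h : G.edist u v ≤ k) (e : G.edgeSet) (hv : v ∈ e.1) (hw : w ∈ e.1) :
    G.edist u w ≤ ((k + 1 : ℕ) : ℕ∞) := by
  rcases eq_or_ne v w with rfl | hne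
  · exact h.trans (by exact_mod_cast Nat.le_succ k)
  · refine edist_le_succ_of_adj G h ?_
    rw [← SimpleGraph.mem_edgeSet, ← (Sym2.mem_and_mem_iff hne).1 ⟨hv, hw⟩]
    exact e.2

/-- Consecutive edges share a vertex, so a step in the graph of edges costs at most one step in `G`.
This transfers ball counts from `G` to its graph of edges. -/
lemma exists_mem_edist_le_of_lineGraph {V : Type*} (G : SimpleGraph V) (e : G.edgeSet) {a : V}
    (ha : a ∈ e.1) (m : ℕ) (f : G.edgeSet) (h : G.lineGraph.edist e f ≤ m) :
    ∃ y ∈ f.1, G.edist a y ≤ m := by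
  induction m generalizing f with
  | zero =>
    have : e = f := by simpa using h
    subst this
    exact ⟨a, ha, by simp⟩
  | succ m ih =>
    by_cases hm : G.lineGraph.edist e f ≤ m
    · obtain ⟨y, hy, hd⟩ := ih f hm
      exact ⟨y, hy, hd.trans (by exact_mod_cast Nat.le_succ m)⟩
    · have h' : G.lineGraph.edist e f = ((m + 1 : ℕ) : ℕ∞) := by
        refine le_antisymm h ?_
        generalize G.lineGraph.edist e f = a at h hm
        lift a to ℕ using ne_top_of_le_ne_top (ENat.natCast_ne_top _) h
        norm_cast at h hm ⊢
        omega
      obtain ⟨-, g, hg, hadj⟩ := (edist_eq_succ_iff _ _ _ _).1 h'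
      obtain ⟨y0, hy0, hd⟩ := ih g hg.le
      obtain ⟨-, y, hy⟩ := hadj
      exact ⟨y, hy.2, edist_le_succ_of_mem_edge G hd g hy0 hy.1⟩

open Classical in
lemma card_lineGraph_edist_le_le {V : Type*} [Fintype V] (G : SimpleGraph V)
    [Fintype G.edgeSet] (K : ℕ) (e : G.edgeSet) :
    (Finset.univ.filter fun f => G.lineGraph.edist e f ≤ (K : ℕ∞)).card
      ≤ doublingConstant G ^ (Nat.log 2 K + 1) * doublingConstant G := by
  have ha := Sym2.out_fst_mem e.1
  set a := (Quot.out e.1).1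
  have hsub : (Finset.univ.filter fun f => G.lineGraph.edist e f ≤ (K : ℕ∞)) ⊆
      (Finset.univ.filter fun w => G.edist a w ≤ (K : ℕ∞)).biUnion
        fun v => Finset.univ.filter fun e : G.edgeSet => v ∈ e.1 := by
    intro f hf
    obtain ⟨y, hy, hd⟩ := exists_mem_edist_le_of_lineGraph G e ha K f (by simpa using hf)
    simp only [Finset.mem_biUnion, Finset.mem_univ, true_and, Finset.mem_filter]
    exact ⟨y, hd, hy⟩
  refine (Finset.card_le_card hsub).trans ?_
  refine (Finset.card_biUnion_le_card_mul _ _ _ fun v _ => card_edges_at_le G v).trans ?_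
  gcongr
  exact card_edist_le_le G K a

/-! ### The random decomposition: possible outcomes and cut probability. -/

open Classical in
-- Replaces the uniform law on the subtype by `uniformOfFinset`, the form that the counted program
-- uses.
lemma dbDimFrom_of_nonempty {V : Type} (H : SimpleGraph V) (Q : PMF ℕ) (W B : Finset V)
    (h : W.Nonempty) :
    dbDimFrom H Q W B = (PMF.uniformOfFinset W h).bind fun u => Q.bind fun q =>
        dbDimFrom H Q (W.filter fun w => (q : ℕ∞) < H.edist u w)
          (B ∪ W.filter fun w => H.edist u w = (q : ℕ∞)) := by
  have : Nonempty ↥W := h.to_subtype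
  have hmap : (PMF.uniformOfFintype ↥W).map Subtype.val = PMF.uniformOfFinset W h := by
    ext u
    rw [PMF.map_apply, PMF.uniformOfFinset_apply]
    by_cases hu : u ∈ W
    · rw [if_pos hu, tsum_eq_single ⟨u, hu⟩]
      · simp
      · rintro ⟨b, hb⟩ hne
        rw [if_neg]
        rintro rfl
        exact hne rfl
    · rw [if_neg hu, ENNReal.tsum_eq_zero]
      rintro ⟨b, hb⟩
      rw [if_neg]
      rintro rfl
      exact hu hb
  rw [dbDimFrom, dif_pos h, ← hmap, PMF.bind_map]
  rfl

lemma dbDimFrom_empty {V : Type} (H : SimpleGraph V) (Q : PMF ℕ) (B : Finset V) :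
    dbDimFrom H Q ∅ B = PMF.pure B := by
  rw [dbDimFrom, dif_neg (by simp)]

open Classical in
lemma mem_support_dbDimFrom {V : Type} (H : SimpleGraph V) (Q : PMF ℕ) (W B B' : Finset V)
    (h : W.Nonempty) :
    B' ∈ (dbDimFrom H Q W B).support ↔ ∃ u ∈ W, ∃ q ∈ Q.support,
      B' ∈ (dbDimFrom H Q (W.filter fun w => (q : ℕ∞) < H.edist u w)
          (B ∪ W.filter fun w => H.edist u w = (q : ℕ∞))).support := by
  rw [dbDimFrom_of_nonempty H Q W B h]
  simp only [PMF.mem_support_bind_iff, PMF.mem_support_uniformOfFinset_iff]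

open Classical in
lemma card_filter_lt_edist_lt {V : Type} (H : SimpleGraph V) (W : Finset V) {u : V} (hu : u ∈ W)
    (q : ℕ) : (W.filter fun w => (q : ℕ∞) < H.edist u w).card < W.card := by
  refine Finset.card_lt_card (Finset.filter_ssubset.2 ⟨u, hu, ?_⟩)
  simp

open Classical in
lemma subset_of_mem_support_dbDimFrom {V : Type} (H : SimpleGraph V) (Q : PMF ℕ)
    (W B B' : Finset V) (h : B' ∈ (dbDimFrom H Q W B).support) : B ⊆ B' ∧ B' ⊆ B ∪ W := by
  induction hk : W.card using Nat.strong_induction_on generalizing W B with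
  | _ k ih =>
    rcases W.eq_empty_or_nonempty with rfl | hW
    · rw [dbDimFrom_empty, PMF.mem_support_pure_iff] at h
      subst h
      simp
    · obtain ⟨u, hu, q, -, h⟩ := (mem_support_dbDimFrom H Q W B B' hW).1 h
      obtain ⟨h1, h2⟩ := ih _ (hk ▸ card_filter_lt_edist_lt H W hu q) _ _ h rfl
      refine ⟨Finset.subset_union_left.trans h1, h2.trans ?_⟩
      intro x hx
      simp only [Finset.mem_union, Finset.mem_filter] at hx ⊢
      tauto

open Classical in
/-- The uncut vertices of a component have been turned red together, by a single center. -/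
lemma exists_center_of_mem_support {V : Type} (H : SimpleGraph V) (Q : PMF ℕ) (K : ℕ)
    (hQ : ∀ q ∈ Q.support, q ≤ K) (W B B' : Finset V) (h : B' ∈ (dbDimFrom H Q W B).support) :
    ∃ c : V → V, (∀ e ∈ W, e ∉ B' → H.edist (c e) e < K) ∧
      ∀ e ∈ W, ∀ f ∈ W, e ∉ B' → f ∉ B' → H.Adj e f → c e = c f := by
  induction hk : W.card using Nat.strong_induction_on generalizing W B with
  | _ k ih =>
    rcases W.eq_empty_or_nonempty with rfl | hW
    · exact ⟨id, by simp, by simp⟩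
    · obtain ⟨u, hu, q, hq, h⟩ := (mem_support_dbDimFrom H Q W B B' hW).1 h
      obtain ⟨c, h1, h2⟩ := ih _ (hk ▸ card_filter_lt_edist_lt H W hu q) _ _ h rfl
      have hsub := (subset_of_mem_support_dbDimFrom H Q _ _ B' h).1
      -- At distance exactly `q` the vertex would be blue, and blue vertices stay blue.
      have hlt : ∀ e ∈ W, e ∉ B' → ¬ (q : ℕ∞) < H.edist u e → H.edist u e < q := by
        intro e he heB hd
        refine lt_of_le_of_ne (not_lt.1 hd) fun heq => heB (hsub ?_)
        simp [he, heq]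
      -- The blue sphere separates red from white: a neighbour of a vertex at distance below `q` is
      -- at distance at most `q`.
      have hadj : ∀ e ∈ W, ∀ f ∈ W, e ∉ B' → H.Adj e f → ¬ (q : ℕ∞) < H.edist u e →
          ¬ (q : ℕ∞) < H.edist u f := by
        intro e he f hf heB hef hd
        rw [not_lt]
        have h3 := hlt e he heB hd
        have h4 : H.edist u f ≤ H.edist u e + H.edist e f := SimpleGraph.edist_triangle
        rw [SimpleGraph.edist_eq_one_iff_adj.2 hef] at h4
        exact h4.trans (Order.add_one_le_of_lt h3)
      refine ⟨fun e => if (q : ℕ∞) < H.edist u e then c e else u, ?_, ?_⟩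
      · intro e he heB
        by_cases hd : (q : ℕ∞) < H.edist u e
        · simp only [hd, if_true]
          exact h1 e (by simp [he, hd]) heB
        · simp only [hd, if_false]
          exact (hlt e he heB hd).trans_le (by exact_mod_cast hQ q hq)
      · intro e he f hf heB hfB hef
        by_cases hd : (q : ℕ∞) < H.edist u e
        · have hd' : (q : ℕ∞) < H.edist u f := by
            by_contra hcon
            exact hadj f hf e he hfB hef.symm hcon hd
          simp only [hd, hd', if_true]
          exact h2 e (by simp [he, hd]) f (by simp [hf, hd']) heB hfB hef
        · have hd' := hadj e he f hf heB hef hd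
          simp only [hd, hd', if_false]

open Classical in
/-- The probability that a white vertex is removed. -/
lemma dbDimFrom_mem_le {V : Type} (H : SimpleGraph V) (Q : PMF ℕ) (K : ℕ) (p : ℝ≥0∞)
    (h0 : Q 0 = 0) (hK : ∀ q, K < q → Q q = 0)
    (hm : ∀ j, 1 ≤ j → j < K → Q j ≤ p * ∑' q, if j ≤ q then Q q else 0)
    (W B : Finset V) (w : V) (hw : w ∈ W) (hB : w ∉ B) :
    (dbDimFrom H Q W B).toOuterMeasure {B' | w ∈ B'} ≤
      p + Q K * ((W.filter fun u => H.edist u w = (K : ℕ∞)).card : ℝ≥0∞) := by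
  induction hk : W.card using Nat.strong_induction_on generalizing W B with
  | _ k ih =>
    have hW : W.Nonempty := ⟨w, hw⟩
    -- The second summand is a budget: one payment of `Q K` for each white vertex at distance `K`,
    -- spent when that vertex becomes a centre.
    set b := p + Q K * ((W.filter fun u => H.edist u w = (K : ℕ∞)).card : ℝ≥0∞) with hb
    rw [dbDimFrom_of_nonempty H Q W B hW, PMF.toOuterMeasure_bind_apply]
    suffices hu : ∀ u ∈ W, (Q.bind fun q =>
        dbDimFrom H Q (W.filter fun w => (q : ℕ∞) < H.edist u w)
          (B ∪ W.filter fun w => H.edist u w = (q : ℕ∞))).toOuterMeasure {B' | w ∈ B'} ≤ b by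
      refine (ENNReal.tsum_le_tsum (g := fun u => PMF.uniformOfFinset W hW u * b)
        fun u => ?_).trans ?_
      · by_cases h : u ∈ W
        · gcongr
          exact hu u h
        · simp [PMF.uniformOfFinset_apply, h]
      · rw [ENNReal.tsum_mul_right, PMF.tsum_coe, one_mul]
    intro u hu
    rw [PMF.toOuterMeasure_bind_apply]
    set g : ℕ → ℝ≥0∞ := fun q => (dbDimFrom H Q (W.filter fun w => (q : ℕ∞) < H.edist u w)
          (B ∪ W.filter fun w => H.edist u w = (q : ℕ∞))).toOuterMeasure {B' | w ∈ B'} with hg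
    have hred : ∀ q : ℕ, H.edist u w < q → g q = 0 := by
      intro q hq
      rw [hg, PMF.toOuterMeasure_apply_eq_zero_iff, Set.disjoint_left]
      intro B' hB' hwB
      have := (subset_of_mem_support_dbDimFrom H Q _ _ B' hB').2 hwB
      simp [hB, hq.ne, not_lt.2 hq.le] at this
    have hone : ∀ q : ℕ, g q ≤ 1 := fun q => by
      refine (MeasureTheory.measure_mono (Set.subset_univ _)).trans_eq ?_
      rw [PMF.toOuterMeasure_apply_eq_one_iff]
      exact Set.subset_univ _
    have hwhite : ∀ q : ℕ, (q : ℕ∞) < H.edist u w → g q ≤ p + Q K *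
        (((W.filter fun w => (q : ℕ∞) < H.edist u w).filter
          fun u => H.edist u w = (K : ℕ∞)).card : ℝ≥0∞) := by
      intro q hq
      refine ih _ (hk ▸ card_filter_lt_edist_lt H W hu q) _ _ (by simp [hw, hq]) ?_ rfl
      simp [hB, hq.ne']
    have hwhite' : ∀ q : ℕ, (q : ℕ∞) < H.edist u w → g q ≤ b := by
      intro q hq
      refine (hwhite q hq).trans ?_
      rw [hb]
      gcongr
      exact Finset.filter_subset _ _
    change ∑' q, Q q * g q ≤ b
    by_cases hd : H.edist u w ≤ K
    · obtain ⟨j, hj'⟩ := ENat.ne_top_iff_exists.1 (ne_top_of_le_ne_top (ENat.natCast_ne_top _) hd)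
      have hj := hj'.symm
      rw [hj] at hd
      simp only [hj] at hred hwhite hwhite'
      have hjK : j ≤ K := by exact_mod_cast hd
      -- If the centre is `w` itself, it turns red, since `Q` is never `0`.
      rcases Nat.eq_zero_or_pos j with rfl | hj1
      · refine le_trans (le_of_eq ?_) (zero_le (a := b))
        rw [ENNReal.tsum_eq_zero]
        intro q
        rcases Nat.eq_zero_or_pos q with rfl | hq
        · simp [h0]
        · rw [hred q (by exact_mod_cast hq), mul_zero]
      rcases hjK.lt_or_eq with hjK | rfl
      -- Distance `j < K`: a draw below `j` leaves `w` white and the induction gives `b`; the draw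
      -- `j` has mass at most `p` times that of the draws `≥ j`, and larger draws turn `w` red. The
      -- total is a convex combination of `b` and a number at most `p ≤ b`.
      · calc ∑' q, Q q * g q
            ≤ ∑' q, ((if q < j then Q q else 0) * b + if q = j then Q j else 0) := by
              refine ENNReal.tsum_le_tsum fun q => ?_
              rcases lt_trichotomy q j with h | rfl | h
              · simp only [h, h.ne, if_true, if_false, add_zero]
                gcongr
                exact hwhite' q (by exact_mod_cast h)
              · simp only [lt_irrefl, if_true, if_false, zero_mul, zero_add]
                exact mul_le_of_le_one_right' (hone q)
              · rw [hred q (by exact_mod_cast h), mul_zero]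
                exact zero_le
          _ ≤ (∑' q, if q < j then Q q else 0) * b + b * ∑' q, if j ≤ q then Q q else 0 := by
              rw [ENNReal.tsum_add, ENNReal.tsum_mul_right, tsum_ite_eq]
              gcongr
              refine (hm j hj1 hjK).trans ?_
              gcongr
              exact le_self_add
          _ = b := by
              rw [mul_comm b, ← add_mul, ← ENNReal.tsum_add]
              have : ∀ q, ((if q < j then Q q else 0) + if j ≤ q then Q q else 0) = Q q := by
                intro q
                split_ifs <;> first | omega | simp
              simp only [this, PMF.tsum_coe, one_mul]
      -- Distance exactly `K` (now called `j`): a smaller draw colours the centre `u`, so one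
      -- payment is freed in the inductive bound; it covers the draw `K`.
      · set c := p + Q j * (((W.erase u).filter
          fun u => H.edist u w = (j : ℕ∞)).card : ℝ≥0∞) with hc
        have hbc : b = c + Q j := by
          rw [hb, hc, add_assoc, Finset.filter_erase, Finset.card_erase_of_mem (by simp [hu, hj])]
          congr 1
          have hpos : 0 < (W.filter fun u => H.edist u w = (j : ℕ∞)).card :=
            Finset.card_pos.2 ⟨u, by simp [hu, hj]⟩
          generalize (W.filter fun u => H.edist u w = (j : ℕ∞)).card = N at hpos
          obtain ⟨N, rfl⟩ := Nat.exists_eq_add_of_lt hpos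
          simp only [zero_add, Nat.add_sub_cancel]
          push_cast
          ring
        calc ∑' q, Q q * g q
            ≤ ∑' q, (Q q * c + if q = j then Q j else 0) := by
              refine ENNReal.tsum_le_tsum fun q => ?_
              rcases lt_trichotomy q j with h | rfl | h
              · simp only [h.ne, if_false, add_zero]
                gcongr
                refine (hwhite q (by exact_mod_cast h)).trans ?_
                rw [hc]
                gcongr
                intro x hx
                simp only [Finset.mem_filter, Finset.mem_erase] at hx ⊢
                refine ⟨?_, hx.1⟩
                rintro rfl
                simp at hx
              · simp only [if_true]
                exact (mul_le_of_le_one_right' (hone q)).trans le_add_self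
              · rw [hred q (by exact_mod_cast h), mul_zero]
                exact zero_le
          _ = b := by
              rw [ENNReal.tsum_add, ENNReal.tsum_mul_right, tsum_ite_eq, PMF.tsum_coe, one_mul,
                hbc]
    -- Distance above `K`: no draw reaches `w`.
    · calc ∑' q, Q q * g q ≤ ∑' q, Q q * b := by
            refine ENNReal.tsum_le_tsum fun q => ?_
            by_cases hq : K < q
            · simp [hK q hq]
            · gcongr
              refine hwhite' q (lt_of_le_of_lt ?_ (not_le.1 hd))
              exact_mod_cast not_lt.1 hq
        _ = b := by rw [ENNReal.tsum_mul_right, PMF.tsum_coe, one_mul]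

lemma stopLaw_apply (p : ℝ) (hp : p ∈ Set.Icc (0 : ℝ) 1) (K i : ℕ) :
    stopLaw p hp K i = ENNReal.ofReal (stopMass p K i) := rfl

lemma stopLaw_zero {p : ℝ} (hp : p ∈ Set.Icc (0 : ℝ) 1) {K : ℕ} (hK : 1 ≤ K) :
    stopLaw p hp K 0 = 0 := by
  have : 0 ≠ K := by omega
  simp [stopLaw_apply, stopMass, this]

lemma stopLaw_self {p : ℝ} (hp : p ∈ Set.Icc (0 : ℝ) 1) (K : ℕ) :
    stopLaw p hp K K = ENNReal.ofReal ((1 - p) ^ (K - 1)) := by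
  simp [stopLaw_apply, stopMass]

lemma stopLaw_of_lt {p : ℝ} (hp : p ∈ Set.Icc (0 : ℝ) 1) {K q : ℕ} (h : K < q) :
    stopLaw p hp K q = 0 := by
  have h1 : ¬ (1 ≤ q ∧ q < K) := by omega
  have h2 : q ≠ K := by omega
  simp [stopLaw_apply, stopMass, h1, h2]

/-- The tail of the truncated law is exactly geometric, because the atom at `K` collects the whole
remaining mass. The induction on `m = K - j` goes downwards from that atom. -/
lemma sum_Ico_stopMass (p : ℝ) (K m : ℕ) :
    ∀ j, 1 ≤ j → j + m = K → ∑ i ∈ Finset.Ico j (K + 1), stopMass p K i = (1 - p) ^ (j - 1) := by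
  induction m with
  | zero =>
    rintro j hj rfl
    simp [stopMass]
  | succ m ih =>
    rintro j hj rfl
    rw [Finset.sum_eq_sum_Ico_succ_bot (by omega), ih (j + 1) (by omega) (by omega), stopMass,
      if_pos (by omega)]
    obtain ⟨j, rfl⟩ := Nat.exists_eq_add_of_le' hj
    simp only [Nat.add_sub_cancel]
    ring

/-- Memorylessness below the truncation, in the form required by `dbDimFrom_mem_le`. -/
lemma stopLaw_le_mul_tail {p : ℝ} (hp : p ∈ Set.Icc (0 : ℝ) 1) {K j : ℕ} (h1 : 1 ≤ j)
    (hj : j < K) : stopLaw p hp K j ≤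
      ENNReal.ofReal p * ∑' q, if j ≤ q then stopLaw p hp K q else 0 := by
  have hsum : ∑ i ∈ Finset.Ico j (K + 1), stopLaw p hp K i ≤
      ∑' q, if j ≤ q then stopLaw p hp K q else 0 := by
    refine le_trans (le_of_eq ?_) (ENNReal.sum_le_tsum (Finset.Ico j (K + 1)))
    refine Finset.sum_congr rfl fun i hi => ?_
    rw [if_pos (Finset.mem_Ico.1 hi).1]
  refine le_trans (le_of_eq ?_) (mul_le_mul_right hsum _)
  simp only [stopLaw_apply]
  rw [← ENNReal.ofReal_sum_of_nonneg fun i _ => stopMass_nonneg hp K i,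
    sum_Ico_stopMass p K (K - j) j h1 (by omega), ← ENNReal.ofReal_mul hp.1, stopMass,
    if_pos ⟨h1, hj⟩]

/-! ### Values, laws and step counts of composed programs. -/

namespace Timed

variable {α β : Type}

@[simp] lemma pure_val (a : α) : (pure a : Timed α).val = a := rfl
@[simp] lemma pure_time (a : α) : (pure a : Timed α).time = 0 := rfl
@[simp] lemma bind_val (a : Timed α) (f : α → Timed β) : (a >>= f).val = (f a.val).val := rfl
@[simp] lemma bind_time (a : Timed α) (f : α → Timed β) :
    (a >>= f).time = a.time + (f a.val).time := rfl

end Timed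

@[simp] lemma tick_time (k : ℕ) : (tick k).time = k := rfl

lemma map_val_andThen {α β : Type} (a : PMF (Timed α)) (f : α → PMF (Timed β)) :
    (andThen a f).map Timed.val = (a.map Timed.val).bind fun x => (f x).map Timed.val := by
  simp only [andThen, PMF.map_bind, PMF.bind_map, PMF.map_comp]
  rfl

lemma mem_support_andThen {α β : Type} (a : PMF (Timed α)) (f : α → PMF (Timed β)) (r : Timed β) :
    r ∈ (andThen a f).support ↔ ∃ x ∈ a.support, ∃ y ∈ (f x.val).support,
      r = ⟨y.val, x.time + y.time⟩ := by
  simp only [andThen, PMF.mem_support_bind_iff, PMF.mem_support_map_iff, eq_comm]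

/-! ### Breadth-first search and the counted decomposition loop. -/

section Search

variable {V : Type} [DecidableEq V]

lemma scan_time (l : List V) (seen : Finset V) (next : List V) :
    (scan l seen next).time = 1 + 3 * l.length := by
  induction l generalizing seen next with
  | nil => simp [scan]
  | cons w l ih =>
    simp only [scan, Timed.bind_time, tick_time, List.length_cons]
    split_ifs <;> rw [ih] <;> ring

lemma mem_scan_fst (l : List V) (seen : Finset V) (next : List V) (x : V) :
    x ∈ (scan l seen next).val.1 ↔ x ∈ seen ∨ x ∈ l := by
  induction l generalizing seen next with
  | nil => simp [scan]
  | cons w l ih =>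
    simp only [scan, Timed.bind_val, List.mem_cons]
    split_ifs with h
    · rw [ih]
      constructor
      · tauto
      · rintro (h' | rfl | h') <;> tauto
    · rw [ih, Finset.mem_insert]
      tauto

lemma mem_scan_snd (l : List V) (seen : Finset V) (next : List V) (x : V) :
    x ∈ (scan l seen next).val.2 ↔ x ∈ next ∨ (x ∉ seen ∧ x ∈ l) := by
  induction l generalizing seen next with
  | nil => simp [scan]
  | cons w l ih =>
    simp only [scan, Timed.bind_val, List.mem_cons]
    split_ifs with h
    · rw [ih]
      constructor
      · tauto
      · rintro (h' | ⟨h1, rfl | h'⟩) <;> tauto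
    · rw [ih, Finset.mem_insert, List.mem_cons]
      by_cases hx : x = w
      · subst hx; tauto
      · tauto

lemma nodup_scan (l : List V) (seen : Finset V) (next : List V) (h : next.Nodup)
    (hs : ∀ x ∈ next, x ∈ seen) : (scan l seen next).val.2.Nodup := by
  induction l generalizing seen next with
  | nil => simpa [scan]
  | cons w l ih =>
    simp only [scan, Timed.bind_val]
    split_ifs with hw
    · exact ih seen next h hs
    · refine ih _ _ (List.nodup_cons.2 ⟨fun hn => hw (hs w hn), h⟩) ?_
      intro x hx
      rcases List.mem_cons.1 hx with rfl | hx
      · exact Finset.mem_insert_self _ _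
      · exact Finset.mem_insert_of_mem (hs x hx)

lemma expand_time_le (adj : V → List V) {d : ℕ} (hd : ∀ v, (adj v).length ≤ d) (l : List V)
    (seen : Finset V) (next : List V) :
    (expand adj l seen next).time ≤ 1 + (2 + 3 * d) * l.length := by
  induction l generalizing seen next with
  | nil => simp [expand]
  | cons v l ih =>
    simp only [expand, Timed.bind_time, tick_time, List.length_cons, scan_time]
    have := ih (scan (adj v) seen next).val.1 (scan (adj v) seen next).val.2
    have := hd v
    linarith

lemma mem_expand_fst (adj : V → List V) (l : List V) (seen : Finset V) (next : List V) (x : V) :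
    x ∈ (expand adj l seen next).val.1 ↔ x ∈ seen ∨ ∃ v ∈ l, x ∈ adj v := by
  induction l generalizing seen next with
  | nil => simp [expand]
  | cons v l ih =>
    simp only [expand, Timed.bind_val]
    rw [ih, mem_scan_fst]
    simp [or_assoc]

lemma mem_expand_snd (adj : V → List V) (l : List V) (seen : Finset V) (next : List V) (x : V) :
    x ∈ (expand adj l seen next).val.2 ↔ x ∈ next ∨ (x ∉ seen ∧ ∃ v ∈ l, x ∈ adj v) := by
  induction l generalizing seen next with
  | nil => simp [expand]
  | cons v l ih =>
    simp only [expand, Timed.bind_val]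
    rw [ih, mem_scan_fst, mem_scan_snd]
    simp only [List.mem_cons, exists_eq_or_imp]
    tauto

lemma nodup_expand (adj : V → List V) (l : List V) (seen : Finset V) (next : List V)
    (h : next.Nodup) (hs : ∀ x ∈ next, x ∈ seen) : (expand adj l seen next).val.2.Nodup := by
  induction l generalizing seen next with
  | nil => simpa [expand]
  | cons v l ih =>
    simp only [expand, Timed.bind_val]
    refine ih _ _ (nodup_scan _ _ _ h hs) ?_
    intro x hx
    rw [mem_scan_snd] at hx
    rw [mem_scan_fst]
    rcases hx with hx | hx
    · exact Or.inl (hs x hx)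
    · exact Or.inr hx.2

lemma paint_time (l : List V) (white painted : Finset V) :
    (paint l white painted).time = 1 + 3 * l.length := by
  induction l generalizing white painted with
  | nil => simp [paint]
  | cons w l ih =>
    simp only [paint, Timed.bind_time, tick_time, List.length_cons]
    split_ifs <;> rw [ih] <;> ring

lemma mem_paint_fst (l : List V) (white painted : Finset V) (x : V) :
    x ∈ (paint l white painted).val.1 ↔ x ∈ white ∧ x ∉ l := by
  induction l generalizing white painted with
  | nil => simp [paint]
  | cons w l ih =>
    simp only [paint, Timed.bind_val, List.mem_cons]
    split_ifs with h
    · rw [ih, Finset.mem_erase]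
      tauto
    · rw [ih]
      constructor
      · rintro ⟨h1, h2⟩
        refine ⟨h1, ?_⟩
        rintro (rfl | h3) <;> tauto
      · tauto

lemma mem_paint_snd (l : List V) (white painted : Finset V) (x : V) :
    x ∈ (paint l white painted).val.2 ↔ x ∈ painted ∨ (x ∈ white ∧ x ∈ l) := by
  induction l generalizing white painted with
  | nil => simp [paint]
  | cons w l ih =>
    simp only [paint, Timed.bind_val, List.mem_cons]
    split_ifs with h
    · rw [ih, Finset.mem_erase, Finset.mem_insert]
      by_cases hx : x = w
      · subst hx; tauto
      · tauto
    · rw [ih]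
      constructor
      · tauto
      · rintro (h1 | ⟨h1, rfl | h2⟩) <;> tauto

/-- The next layer of breadth-first search. -/
lemma expand_layer (H : SimpleGraph V) (adj : V → List V) (hadj : ∀ v x, x ∈ adj v ↔ H.Adj v x)
    (u : V) (k : ℕ) (layer : List V) (seen : Finset V)
    (hl : ∀ x, x ∈ layer ↔ H.edist u x = k) (hs : ∀ x, x ∈ seen ↔ H.edist u x ≤ k) (y : V) :
    (y ∈ (expand adj layer seen []).val.2 ↔ H.edist u y = ((k + 1 : ℕ) : ℕ∞)) ∧
    (y ∈ (expand adj layer seen []).val.1 ↔ H.edist u y ≤ ((k + 1 : ℕ) : ℕ∞)) := by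
  have hsucc := edist_eq_succ_iff H u y k
  rw [mem_expand_snd, mem_expand_fst, hsucc]
  simp only [hs, hl, hadj, List.not_mem_nil, false_or, true_and]
  constructor
  · rintro (h | ⟨v, hv, hvy⟩)
    · exact h.trans (by exact_mod_cast Nat.le_succ k)
    · exact edist_le_succ_of_adj H hv.le hvy
  · intro h
    by_cases hk : H.edist u y ≤ k
    · exact Or.inl hk
    · exact Or.inr (hsucc.1 (le_antisymm h (by
        push_cast
        exact Order.add_one_le_of_lt (not_le.1 hk)))).2

/-- Breadth-first search from the layer at distance `k` paints the vertices according to their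
distance. -/
lemma sweep_val (H : SimpleGraph V) (adj : V → List V) (hadj : ∀ v x, x ∈ adj v ↔ H.Adj v x)
    (u : V) (q k : ℕ) (layer : List V) (seen white blue red : Finset V)
    (hl : ∀ x, x ∈ layer ↔ H.edist u x = k) (hs : ∀ x, x ∈ seen ↔ H.edist u x ≤ k)
    (hw : ∀ x ∈ white, (k : ℕ∞) ≤ H.edist u x) (x : V) :
    (x ∈ (sweep adj q layer seen white blue red).val.1 ↔
      x ∈ white ∧ ((k + q : ℕ) : ℕ∞) < H.edist u x) ∧
    (x ∈ (sweep adj q layer seen white blue red).val.2.1 ↔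
      x ∈ blue ∨ (x ∈ white ∧ H.edist u x = ((k + q : ℕ) : ℕ∞))) := by
  induction q generalizing k layer seen white blue red with
  | zero =>
    simp only [sweep, Timed.bind_val, Timed.pure_val, mem_paint_fst, mem_paint_snd, hl, add_zero]
    refine ⟨?_, trivial⟩
    refine and_congr_right fun hx => ?_
    rw [lt_iff_le_and_ne]
    exact ⟨fun h => ⟨hw x hx, Ne.symm h⟩, fun h => Ne.symm h.2⟩
  | succ q ih =>
    simp only [sweep, Timed.bind_val]
    have key := ih (k + 1) (expand adj layer seen []).val.2 (expand adj layer seen []).val.1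
      (paint layer white red).val.1 blue (paint layer white red).val.2
      (fun y => (expand_layer H adj hadj u k layer seen hl hs y).1)
      (fun y => (expand_layer H adj hadj u k layer seen hl hs y).2) ?_
    · rw [show k + 1 + q = k + (q + 1) by ring] at key
      refine ⟨key.1.trans ?_, key.2.trans ?_⟩
      · rw [mem_paint_fst, hl]
        constructor
        · tauto
        · rintro ⟨h1, h2⟩
          refine ⟨⟨h1, fun h => ?_⟩, h2⟩
          rw [h] at h2
          norm_cast at h2
          omega
      · rw [mem_paint_fst, hl]
        constructor
        · tauto
        · rintro (h | ⟨h1, h2⟩)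
          · exact Or.inl h
          · refine Or.inr ⟨⟨h1, fun h => ?_⟩, h2⟩
            rw [h] at h2
            norm_cast at h2
            omega
    · intro y hy
      rw [mem_paint_fst, hl] at hy
      push_cast
      exact Order.add_one_le_of_lt (lt_of_le_of_ne (hw y hy.1) (Ne.symm hy.2))

open Classical in
-- A level costs at most `3` plus, for each vertex of its layer, `3` for painting and `2 + 3 * d`
-- for expanding. The layers are disjoint, so the second part adds up over an annulus.
lemma sweep_time_le [Fintype V] (H : SimpleGraph V) (adj : V → List V)
    (hadj : ∀ v x, x ∈ adj v ↔ H.Adj v x) {d : ℕ} (hd : ∀ v, (adj v).length ≤ d)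
    (u : V) (q k : ℕ) (layer : List V) (seen white blue red : Finset V) (hn : layer.Nodup)
    (hl : ∀ x, x ∈ layer ↔ H.edist u x = k) (hs : ∀ x, x ∈ seen ↔ H.edist u x ≤ k) :
    (sweep adj q layer seen white blue red).time ≤ 3 * (q + 1) + (5 + 3 * d) *
      (Finset.univ.filter fun x => (k : ℕ∞) ≤ H.edist u x ∧
        H.edist u x ≤ ((k + q : ℕ) : ℕ∞)).card := by
  have hlen : layer.length = (Finset.univ.filter fun x => H.edist u x = k).card := by
    rw [← List.toFinset_card_of_nodup hn]
    congr 1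
    ext x
    simp [hl]
  induction q generalizing k layer seen white blue red with
  | zero =>
    simp only [sweep, Timed.bind_time, Timed.pure_time, paint_time, tick_time]
    rw [hlen]
    have : (Finset.univ.filter fun x => H.edist u x = k).card ≤
        (Finset.univ.filter fun x => (k : ℕ∞) ≤ H.edist u x ∧
          H.edist u x ≤ ((k + 0 : ℕ) : ℕ∞)).card := by
      refine Finset.card_le_card fun x => ?_
      simp +contextual
    nlinarith
  | succ q ih =>
    simp only [sweep, Timed.bind_time, paint_time, tick_time]
    have hl' := fun y => (expand_layer H adj hadj u k layer seen hl hs y).1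
    have hs' := fun y => (expand_layer H adj hadj u k layer seen hl hs y).2
    have hn' : (expand adj layer seen []).val.2.Nodup := nodup_expand _ _ _ _ (by simp) (by simp)
    have key := ih (k + 1) (expand adj layer seen []).val.2 (expand adj layer seen []).val.1
      (paint layer white red).val.1 blue (paint layer white red).val.2 hn' hl' hs' (by
        rw [← List.toFinset_card_of_nodup hn']
        congr 1
        ext x
        rw [List.mem_toFinset, hl']
        simp)
    have hexp := expand_time_le adj hd layer seen []
    have hcard : (Finset.univ.filter fun x => ((k + 1 : ℕ) : ℕ∞) ≤ H.edist u x ∧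
          H.edist u x ≤ ((k + 1 + q : ℕ) : ℕ∞)).card + layer.length ≤
        (Finset.univ.filter fun x => (k : ℕ∞) ≤ H.edist u x ∧
          H.edist u x ≤ ((k + (q + 1) : ℕ) : ℕ∞)).card := by
      rw [hlen, ← Finset.card_union_of_disjoint]
      · refine Finset.card_le_card fun x => ?_
        simp only [Finset.mem_union, Finset.mem_filter, Finset.mem_univ, true_and]
        rintro (⟨h1, h2⟩ | h)
        · refine ⟨le_trans (by exact_mod_cast Nat.le_succ k) h1, h2.trans ?_⟩
          exact_mod_cast (by omega : k + 1 + q ≤ k + (q + 1))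
        · rw [h]
          exact ⟨le_rfl, by exact_mod_cast Nat.le_add_right _ _⟩
      · rw [Finset.disjoint_left]
        intro x hx hx'
        simp only [Finset.mem_filter, Finset.mem_univ, true_and] at hx hx'
        rw [hx'] at hx
        have := hx.1
        norm_cast at this
        omega
    have := Nat.mul_le_mul_left (5 + 3 * d) hcard
    linarith

/-- Every iteration colours at least its centre, so the iteration bound `k` never cuts the loop
short. -/
lemma dbDimRun_map_val (H : SimpleGraph V) (adj : V → List V)
    (hadj : ∀ v x, x ∈ adj v ↔ H.Adj v x) (Q : PMF ℕ) (K k : ℕ) (white blue red : Finset V)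
    (hk : white.card ≤ k) :
    (dbDimRun adj Q K k white blue red).map Timed.val = dbDimFrom H Q white blue := by
  induction k generalizing white blue red with
  | zero =>
    have : white = ∅ := by simpa using hk
    subst this
    simp [dbDimRun, dbDimFrom_empty, PMF.pure_map]
  | succ k ih =>
    rw [dbDimRun]
    split_ifs with h
    · rw [dbDimFrom_of_nonempty H Q white blue h, PMF.map_bind]
      have hset : ∀ u ∈ white, ∀ q : ℕ,
          (andThen (PMF.pure (do tick (K + 4); sweep adj q [u] {u} white blue red))
            fun r => dbDimRun adj Q K k r.1 r.2.1 r.2.2).map Timed.val =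
          dbDimFrom H Q (white.filter fun w => (q : ℕ∞) < H.edist u w)
          (blue ∪ white.filter fun w => H.edist u w = (q : ℕ∞)) := by
        intro u hu q
        have hval := sweep_val H adj hadj u q 0 [u] {u} white blue red (fun x => by simpa using eq_comm)
          (fun x => by simpa using eq_comm) (by simp)
        simp only [zero_add] at hval
        have e1 : (sweep adj q [u] {u} white blue red).val.1 =
            white.filter fun w => (q : ℕ∞) < H.edist u w := by
          ext x; rw [(hval x).1, Finset.mem_filter]
        have e2 : (sweep adj q [u] {u} white blue red).val.2.1 =
            blue ∪ white.filter fun w => H.edist u w = (q : ℕ∞) := by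
          ext x; rw [(hval x).2, Finset.mem_union, Finset.mem_filter]
        rw [map_val_andThen, PMF.pure_map, PMF.pure_bind, ih]
        · simp only [Timed.bind_val, e1, e2]
        · simp only [Timed.bind_val, e1]
          have := card_filter_lt_edist_lt H white hu q
          omega
      ext s
      rw [PMF.bind_apply, PMF.bind_apply]
      -- Vertices outside `white` have mass `0`, so the comparison is needed for white centres only.
      refine tsum_congr fun u => ?_
      by_cases hu : u ∈ white
      · congr 1
        rw [PMF.map_bind]
        simp only [hset u hu]
        congr! 4
        ext x
        simp only [Finset.mem_union]
      · simp [PMF.uniformOfFinset_apply, hu]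
    · rw [Finset.not_nonempty_iff_eq_empty] at h
      subst h
      simp [dbDimFrom_empty, PMF.pure_map]

open Classical in
-- An iteration is charged `K + 4`, and its sweep at most `3 * (K + 1) + (5 + 3 * d) * A`.
lemma dbDimRun_time_le [Fintype V] (H : SimpleGraph V) (adj : V → List V)
    (hadj : ∀ v x, x ∈ adj v ↔ H.Adj v x) {d : ℕ} (hd : ∀ v, (adj v).length ≤ d) (Q : PMF ℕ)
    (K A : ℕ) (hQ : ∀ q ∈ Q.support, q ≤ K)
    (hA : ∀ u, (Finset.univ.filter fun x => H.edist u x ≤ (K : ℕ∞)).card ≤ A)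
    (k : ℕ) (white blue red : Finset V) (r : Timed (Finset V))
    (hr : r ∈ (dbDimRun adj Q K k white blue red).support) :
    r.time ≤ 1 + k * (4 * K + 7 + (5 + 3 * d) * A) := by
  induction k generalizing white blue red r with
  | zero =>
    simp only [dbDimRun, PMF.mem_support_pure_iff] at hr
    simp [hr]
  | succ k ih =>
    rw [dbDimRun] at hr
    split_ifs at hr with h
    · simp only [PMF.mem_support_bind_iff, mem_support_andThen, PMF.mem_support_pure_iff,
        exists_eq_left] at hr
      obtain ⟨u, -, q, hq, y, hy, rfl⟩ := hr
      have h1 := ih _ _ _ y hy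
      have h2 := sweep_time_le H adj hadj hd u q 0 [u] {u} white blue red (by simp)
        (fun x => by simpa using eq_comm) (fun x => by simpa using eq_comm)
      have h3 : (Finset.univ.filter fun x => ((0 : ℕ) : ℕ∞) ≤ H.edist u x ∧
        H.edist u x ≤ ((0 + q : ℕ) : ℕ∞)).card ≤ A := by
        refine (Finset.card_le_card fun x => ?_).trans (hA u)
        simp only [Finset.mem_filter, Finset.mem_univ, true_and, zero_add]
        rintro ⟨-, hx⟩
        exact hx.trans (by exact_mod_cast hQ q hq)
      have h4 := Nat.mul_le_mul_left (5 + 3 * d) h3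
      have h5 := hQ q hq
      simp only [Timed.bind_time, tick_time]
      linarith
    · simp only [PMF.mem_support_pure_iff] at hr
      simp [hr]

end Search

/-- Breadth-first search finds the part of the connected component of `v` outside a closed set
`seen₀`. -/
lemma explore_spec {V : Type} [DecidableEq V] [Fintype V] (G : SimpleGraph V) (adj : V → List V)
    (hadj : ∀ v x, x ∈ adj v ↔ G.Adj v x) {d : ℕ} (hd : ∀ v, (adj v).length ≤ d)
    (seen₀ : Finset V) (v : V) (k : ℕ) (layer : List V) (seen : Finset V) (acc : List V)
    (hseen : ∀ x, x ∈ seen ↔ x ∈ seen₀ ∨ x ∈ acc ∨ x ∈ layer)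
    (hdisj : ∀ x, x ∈ acc ∨ x ∈ layer → x ∉ seen₀ ∧ G.Reachable v x)
    (hnodup : (layer ++ acc).Nodup) (hcl : ∀ x ∈ acc, ∀ y, G.Adj x y → y ∈ seen)
    (hk : Fintype.card V ≤ k + acc.length) :
    (∀ x, x ∈ (explore adj k layer seen acc).val.1 ↔
      x ∈ seen₀ ∨ x ∈ (explore adj k layer seen acc).val.2) ∧
    (explore adj k layer seen acc).val.2.Nodup ∧
    (∀ x ∈ (explore adj k layer seen acc).val.2, x ∉ seen₀ ∧ G.Reachable v x) ∧
    (∀ x ∈ (explore adj k layer seen acc).val.2, ∀ y, G.Adj x y →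
      y ∈ (explore adj k layer seen acc).val.1) ∧
    (∀ x, x ∈ acc ∨ x ∈ layer → x ∈ (explore adj k layer seen acc).val.2) ∧
    (explore adj k layer seen acc).time + (5 + 3 * d) * acc.length ≤
      1 + (5 + 3 * d) * (explore adj k layer seen acc).val.2.length := by
  -- Both stopping rules, no rounds left and empty layer, return the same pair.
  have hdone : layer = [] → ∀ r : Timed (Finset V × List V), r.val = (seen, acc) → r.time = 1 →
      (∀ x, x ∈ r.val.1 ↔ x ∈ seen₀ ∨ x ∈ r.val.2) ∧ r.val.2.Nodup ∧
      (∀ x ∈ r.val.2, x ∉ seen₀ ∧ G.Reachable v x) ∧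
      (∀ x ∈ r.val.2, ∀ y, G.Adj x y → y ∈ r.val.1) ∧
      (∀ x, x ∈ acc ∨ x ∈ layer → x ∈ r.val.2) ∧
      r.time + (5 + 3 * d) * acc.length ≤ 1 + (5 + 3 * d) * r.val.2.length := by
    rintro rfl r hr ht
    rw [hr, ht]
    refine ⟨by simpa using hseen, by simpa using hnodup, fun x hx => hdisj x (Or.inl hx), hcl,
      by simp, le_rfl⟩
  induction k generalizing layer seen acc with
  | zero =>
    have hlen : (layer ++ acc).length ≤ Fintype.card V := List.Nodup.length_le_card hnodup
    -- With no rounds left, `acc` already has as many distinct entries as there are vertices.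
    have hl : layer = [] := by
      rw [List.length_append] at hlen
      exact List.length_eq_zero_iff.1 (by omega)
    exact hdone hl _ (by simp [explore]) (by simp [explore])
  | succ k ih =>
    match layer with
    | [] => exact hdone rfl _ (by simp [explore]) (by simp [explore])
    | w :: l =>
      simp only [explore, Timed.bind_val, Timed.bind_time, tick_time]
      set s := expand adj (w :: l) seen [] with hs
      have hs1 : ∀ x, x ∈ s.val.1 ↔ x ∈ seen ∨ ∃ u ∈ w :: l, x ∈ adj u := mem_expand_fst _ _ _ _
      have hs2 : ∀ x, x ∈ s.val.2 ↔ x ∉ seen ∧ ∃ u ∈ w :: l, x ∈ adj u := fun x =>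
        (mem_expand_snd _ _ _ _ _).trans (by simp)
      have hst : s.time ≤ 1 + (2 + 3 * d) * (w :: l).length := expand_time_le adj hd _ _ _
      have h1 : ∀ x, x ∈ s.val.1 ↔ x ∈ seen₀ ∨ x ∈ w :: l ++ acc ∨ x ∈ s.val.2 := by
        intro x
        rw [hs1, hs2, hseen, List.mem_append]
        tauto
      have h2 : ∀ x, x ∈ w :: l ++ acc ∨ x ∈ s.val.2 → x ∉ seen₀ ∧ G.Reachable v x := by
        intro x hx
        rcases hx with hx | hx
        · exact hdisj x ((List.mem_append.1 hx).symm)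
        · obtain ⟨h3, u, hu, hux⟩ := (hs2 x).1 hx
          refine ⟨fun h => h3 ((hseen x).2 (Or.inl h)), ?_⟩
          exact (hdisj u (Or.inr hu)).2.trans ((hadj u x).1 hux).reachable
      have h3 : (s.val.2 ++ (w :: l ++ acc)).Nodup := by
        refine List.Nodup.append (nodup_expand _ _ _ _ (by simp) (by simp)) hnodup ?_
        intro x hx hx'
        exact ((hs2 x).1 hx).1 ((hseen x).2 (Or.inr (List.mem_append.1 hx').symm))
      have h4 : ∀ x ∈ w :: l ++ acc, ∀ y, G.Adj x y → y ∈ s.val.1 := by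
        intro x hx y hxy
        rw [hs1]
        rcases List.mem_append.1 hx with hx | hx
        · exact Or.inr ⟨x, hx, (hadj x y).2 hxy⟩
        · exact Or.inl (hcl x hx y hxy)
      have h5 : Fintype.card V ≤ k + (w :: l ++ acc).length := by
        simp only [List.length_append, List.length_cons]
        omega
      obtain ⟨g1, g2, g3, g4, g5, g6⟩ := ih s.val.2 s.val.1 (w :: l ++ acc) h1 h2 h3 h4 h5 (by
        intro he r hr ht
        rw [hr, ht]
        refine ⟨fun x => ?_, (List.nodup_append.1 h3).2.1, fun x hx => h2 x (Or.inl hx), h4,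
          ?_, le_rfl⟩
        · rw [h1, he]
          simp
        · rw [he]
          simp)
      refine ⟨g1, g2, g3, g4, ?_, ?_⟩
      · intro x hx
        exact g5 x (Or.inl (List.mem_append.2 hx.symm))
      -- A round costs at most `2 + (3 + 3 * d)` times the layer; the layer is nonempty, which
      -- absorbs the `2`.
      · simp only [List.length_append, List.length_cons] at g6 hst
        linarith

/-! ### Adjacency tables of the graph of edges and of the cut graph. -/

namespace MRF

variable {n : ℕ} {S : Type} (M : MRF n S)

lemma mk_lo_hi (e : M.Edge) : e.1 = s(M.lo e, M.hi e) := by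
  unfold lo hi
  induction e.1 using Sym2.ind with
  | _ a b =>
    rcases le_total a b with h | h
    · simp [h]
    · simp [h, Sym2.eq_swap]

lemma mem_edge_iff (e : M.Edge) (v : Fin n) : v ∈ e.1 ↔ v = M.lo e ∨ v = M.hi e := by
  rw [M.mk_lo_hi e, Sym2.mem_iff]

lemma adj_lo_hi (e : M.Edge) : M.graph.Adj (M.lo e) (M.hi e) := by
  rw [← SimpleGraph.mem_edgeSet, ← M.mk_lo_hi]
  exact e.2

lemma cutGraph_adj (B : Finset M.Edge) (u v : Fin n) :
    (M.cutGraph B).Adj u v ↔ ∃ e : M.Edge, e ∉ B ∧ e.1 = s(u, v) := by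
  unfold cutGraph
  rw [SimpleGraph.deleteEdges_adj]
  constructor
  · rintro ⟨h, hB⟩
    refine ⟨⟨s(u, v), h⟩, fun hmem => hB ⟨_, hmem, rfl⟩, rfl⟩
  · rintro ⟨e, he, heq⟩
    refine ⟨by rw [← SimpleGraph.mem_edgeSet, ← heq]; exact e.2, ?_⟩
    rintro ⟨f, hf, hfe⟩
    have : f = e := Subtype.ext (hfe.trans heq.symm)
    exact he (this ▸ hf)

lemma cutGraph_adj_lo_hi (B : Finset M.Edge) {e : M.Edge} (he : e ∉ B) :
    (M.cutGraph B).Adj (M.lo e) (M.hi e) :=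
  (M.cutGraph_adj B _ _).2 ⟨e, he, M.mk_lo_hi e⟩

lemma mem_inc (v : Fin n) (e : M.Edge) : e ∈ M.inc v ↔ v ∈ e.1 := by
  simp [inc]

lemma nodup_inc (v : Fin n) : (M.inc v).Nodup := Finset.nodup_toList _

lemma length_inc_le (v : Fin n) : (M.inc v).length ≤ doublingConstant M.graph := by
  rw [inc, Finset.length_toList]
  convert card_edges_at_le M.graph v

lemma mem_copyOthers (e : M.Edge) (l acc : List M.Edge) (x : M.Edge) :
    x ∈ (M.copyOthers e l acc).val ↔ x ∈ acc ∨ (x ∈ l ∧ x ≠ e) := by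
  induction l generalizing acc with
  | nil => simp [copyOthers]
  | cons f l ih =>
    simp only [copyOthers, Timed.bind_val, List.mem_cons]
    split_ifs with h
    · rw [ih]
      constructor
      · tauto
      · rintro (h1 | ⟨rfl | h1, h2⟩) <;> tauto
    · rw [ih, List.mem_cons]
      constructor
      · rintro ((rfl | h1) | h1) <;> tauto
      · tauto

lemma length_copyOthers_le (e : M.Edge) (l acc : List M.Edge) :
    (M.copyOthers e l acc).val.length ≤ acc.length + l.length := by
  induction l generalizing acc with
  | nil => simp [copyOthers]
  | cons f l ih =>
    simp only [copyOthers, Timed.bind_val, List.length_cons]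
    split_ifs
    · exact (ih acc).trans (by omega)
    · exact (ih (f :: acc)).trans (by rw [List.length_cons]; omega)

lemma copyOthers_time (e : M.Edge) (l acc : List M.Edge) :
    (M.copyOthers e l acc).time = 1 + 2 * l.length := by
  induction l generalizing acc with
  | nil => simp [copyOthers]
  | cons f l ih =>
    simp only [copyOthers, Timed.bind_time, tick_time, List.length_cons]
    split_ifs <;> rw [ih] <;> ring

/-- The neighbours of an edge in the graph of edges, as computed by `edgeAdj`. -/
noncomputable def neighborEdges (e : M.Edge) : List M.Edge :=
  (M.copyOthers e (M.inc (M.hi e)) (M.copyOthers e (M.inc (M.lo e)) []).val).val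

lemma mem_neighborEdges (e x : M.Edge) :
    x ∈ M.neighborEdges e ↔ M.graph.lineGraph.Adj e x := by
  rw [neighborEdges, mem_copyOthers, mem_copyOthers, mem_inc, mem_inc,
    SimpleGraph.lineGraph_adj_iff_exists]
  simp only [mem_edge_iff M e, List.not_mem_nil, false_or, exists_eq_or_imp, exists_eq_left]
  tauto

lemma length_neighborEdges_le (e : M.Edge) :
    (M.neighborEdges e).length ≤ 2 * doublingConstant M.graph := by
  refine (M.length_copyOthers_le _ _ _).trans ?_
  have h1 := M.length_copyOthers_le e (M.inc (M.lo e)) []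
  have h2 := M.length_inc_le (M.lo e)
  have h3 := M.length_inc_le (M.hi e)
  simp only [List.length_nil] at h1
  omega

lemma edgeAdj_val (l : List M.Edge) (tab : M.Edge → List M.Edge)
    (h : ∀ f, f ∉ l → tab f = M.neighborEdges f) : (M.edgeAdj l tab).val = M.neighborEdges := by
  induction l generalizing tab with
  | nil =>
    funext f
    simpa [edgeAdj] using h f
  | cons e l ih =>
    simp only [edgeAdj, Timed.bind_val]
    refine ih _ fun f hf => ?_
    by_cases hfe : f = e
    · subst hfe
      rw [Function.update_self]
      rfl
    · rw [Function.update_of_ne hfe]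
      exact h f (by simp [hfe, hf])

lemma edgeAdj_time_le (l : List M.Edge) (tab : M.Edge → List M.Edge) :
    (M.edgeAdj l tab).time ≤ 1 + l.length * (4 + 4 * doublingConstant M.graph) := by
  induction l generalizing tab with
  | nil => simp [edgeAdj]
  | cons e l ih =>
    simp only [edgeAdj, Timed.bind_time, tick_time, List.length_cons, copyOthers_time]
    have h1 := ih (Function.update tab e (M.neighborEdges e))
    have h2 := M.length_inc_le (M.lo e)
    have h3 := M.length_inc_le (M.hi e)
    unfold neighborEdges at h1
    linarith

lemma decompRun_map_val (p : ℝ) (hp : p ∈ Set.Icc (0 : ℝ) 1) (K : ℕ) :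
    (M.decompRun p hp K).map Timed.val = dbDim M.graph.lineGraph p hp K := by
  rw [decompRun, map_val_andThen, PMF.pure_map, PMF.pure_bind, Timed.bind_val,
    M.edgeAdj_val _ _ (by simp)]
  exact dbDimRun_map_val M.graph.lineGraph M.neighborEdges M.mem_neighborEdges _ _ _ _ _ _
    (by simp)

lemma le_of_mem_support_stopLaw {p : ℝ} (hp : p ∈ Set.Icc (0 : ℝ) 1) {K q : ℕ}
    (hq : q ∈ (stopLaw p hp K).support) : q ≤ K := by
  by_contra h
  exact (PMF.mem_support_iff _ _).1 hq (stopLaw_of_lt hp (not_le.1 h))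

lemma decompRun_time_le (p : ℝ) (hp : p ∈ Set.Icc (0 : ℝ) 1) (K : ℕ) (r : Timed (Finset M.Edge))
    (hr : r ∈ (M.decompRun p hp K).support) :
    r.time ≤ 3 + Fintype.card M.Edge * (4 * K + 14 + 4 * doublingConstant M.graph +
      (5 + 6 * doublingConstant M.graph) *
        (doublingConstant M.graph ^ (Nat.log 2 K + 1) * doublingConstant M.graph)) := by
  rw [decompRun, mem_support_andThen] at hr
  simp only [PMF.mem_support_pure_iff, exists_eq_left, Timed.bind_val, Timed.bind_time,
    tick_time] at hr
  obtain ⟨y, hy, rfl⟩ := hr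
  rw [M.edgeAdj_val _ _ (by simp)] at hy
  have h1 := dbDimRun_time_le M.graph.lineGraph M.neighborEdges M.mem_neighborEdges
    M.length_neighborEdges_le _ K _ (fun q hq => le_of_mem_support_stopLaw hp hq)
    (card_lineGraph_edist_le_le M.graph K) _ _ _ _ _ hy
  have h2 := M.edgeAdj_time_le Finset.univ.toList fun _ => []
  rw [Finset.length_toList, Finset.card_univ] at h2
  simp only
  generalize Fintype.card M.Edge = m at *
  generalize doublingConstant M.graph ^ (Nat.log 2 K + 1) * doublingConstant M.graph = A at *
  nlinarith

lemma keepRow_snd (B : Finset M.Edge) (v : Fin n) (l : List M.Edge) (nb : List (Fin n))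
    (low : List M.Edge) :
    (M.keepRow B v l nb low).val.2 =
      (l.filter fun e => e ∉ B ∧ M.lo e = v).reverse ++ low := by
  induction l generalizing nb low with
  | nil => simp [keepRow]
  | cons e l ih =>
    simp only [keepRow, Timed.bind_val]
    split_ifs with h1 h2
    · rw [ih]
      simp [h1]
    · rw [ih]
      simp [h1, h2]
    · rw [ih]
      simp [h2]

lemma mem_keepRow_fst (B : Finset M.Edge) (v : Fin n) (l : List M.Edge) (nb : List (Fin n))
    (low : List M.Edge) (x : Fin n) :
    x ∈ (M.keepRow B v l nb low).val.1 ↔ x ∈ nb ∨ ∃ e ∈ l, e ∉ B ∧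
      ((M.lo e = v ∧ x = M.hi e) ∨ (M.lo e ≠ v ∧ x = M.lo e)) := by
  induction l generalizing nb low with
  | nil => simp [keepRow]
  | cons e l ih =>
    simp only [keepRow, Timed.bind_val, List.mem_cons, exists_eq_or_imp]
    split_ifs with h1 h2
    · rw [ih]
      simp [h1]
    · rw [ih, List.mem_cons, or_assoc, or_left_comm]
      simp [h1, h2]
    · rw [ih, List.mem_cons, or_assoc, or_left_comm]
      simp [h1, h2]

lemma length_keepRow_fst_le (B : Finset M.Edge) (v : Fin n) (l : List M.Edge) (nb : List (Fin n))
    (low : List M.Edge) : (M.keepRow B v l nb low).val.1.length ≤ nb.length + l.length := by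
  induction l generalizing nb low with
  | nil => simp [keepRow]
  | cons e l ih =>
    simp only [keepRow, Timed.bind_val, List.length_cons]
    split_ifs
    · exact (ih _ _).trans (by omega)
    · exact (ih _ _).trans (by rw [List.length_cons]; omega)
    · exact (ih _ _).trans (by rw [List.length_cons]; omega)

lemma keepRow_time (B : Finset M.Edge) (v : Fin n) (l : List M.Edge) (nb : List (Fin n))
    (low : List M.Edge) : (M.keepRow B v l nb low).time = 1 + 4 * l.length := by
  induction l generalizing nb low with
  | nil => simp [keepRow]
  | cons e l ih =>
    simp only [keepRow, Timed.bind_time, tick_time, List.length_cons]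
    split_ifs <;> rw [ih] <;> ring

/-- The neighbours of a vertex and the edges of which it is the smaller endpoint, in the graph
without the removed edges. -/
noncomputable def keptAt (B : Finset M.Edge) (v : Fin n) : List (Fin n) × List M.Edge :=
  (M.keepRow B v (M.inc v) [] []).val

lemma keepTable_val (B : Finset M.Edge) (l : List (Fin n))
    (tab : Fin n → List (Fin n) × List M.Edge) (h : ∀ v, v ∉ l → tab v = M.keptAt B v) :
    (M.keepTable B l tab).val = M.keptAt B := by
  induction l generalizing tab with
  | nil =>
    funext f
    simpa [keepTable] using h f
  | cons e l ih =>
    simp only [keepTable, Timed.bind_val]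
    refine ih _ fun f hf => ?_
    by_cases hfe : f = e
    · subst hfe
      rw [Function.update_self]
      rfl
    · rw [Function.update_of_ne hfe]
      exact h f (by simp [hfe, hf])

lemma keepTable_time_le (B : Finset M.Edge) (l : List (Fin n))
    (tab : Fin n → List (Fin n) × List M.Edge) :
    (M.keepTable B l tab).time ≤ 1 + l.length * (3 + 4 * doublingConstant M.graph) := by
  induction l generalizing tab with
  | nil => simp [keepTable]
  | cons v l ih =>
    simp only [keepTable, Timed.bind_time, tick_time, List.length_cons, keepRow_time]
    have h1 := ih (Function.update tab v (M.keptAt B v))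
    have h2 := M.length_inc_le v
    unfold keptAt at h1
    linarith

lemma mem_keptAt_fst (B : Finset M.Edge) (v x : Fin n) :
    x ∈ (M.keptAt B v).1 ↔ (M.cutGraph B).Adj v x := by
  rw [keptAt, mem_keepRow_fst, cutGraph_adj]
  simp only [List.not_mem_nil, false_or, mem_inc]
  constructor
  · rintro ⟨e, hv, he, h⟩
    refine ⟨e, he, ?_⟩
    rw [M.mk_lo_hi e]
    rcases h with ⟨h1, h2⟩ | ⟨h1, h2⟩
    · rw [h1, h2]
    · rw [mem_edge_iff] at hv
      rw [h2, hv.resolve_left (Ne.symm h1), Sym2.eq_swap]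
  · rintro ⟨e, he, heq⟩
    refine ⟨e, by simp [heq], he, ?_⟩
    have hne := (M.adj_lo_hi e).ne
    rw [M.mk_lo_hi e, Sym2.eq_iff] at heq
    rcases heq with ⟨h1, h2⟩ | ⟨h1, h2⟩
    · exact Or.inl ⟨h1, h2.symm⟩
    · refine Or.inr ⟨fun h => hne (h.trans h2.symm), h1.symm⟩

lemma length_keptAt_fst_le (B : Finset M.Edge) (v : Fin n) :
    (M.keptAt B v).1.length ≤ doublingConstant M.graph := by
  refine (M.length_keepRow_fst_le B v (M.inc v) [] []).trans ?_
  simpa using M.length_inc_le v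

lemma mem_keptAt_snd (B : Finset M.Edge) (v : Fin n) (e : M.Edge) :
    e ∈ (M.keptAt B v).2 ↔ e ∉ B ∧ M.lo e = v := by
  rw [keptAt, keepRow_snd]
  simp only [List.append_nil, List.mem_reverse, List.mem_filter, mem_inc, decide_eq_true_eq,
    mem_edge_iff]
  constructor
  · tauto
  · rintro ⟨h1, h2⟩
    exact ⟨Or.inl h2.symm, h1, h2⟩

lemma nodup_keptAt_snd (B : Finset M.Edge) (v : Fin n) : (M.keptAt B v).2.Nodup := by
  rw [keptAt, keepRow_snd]
  simpa using (M.nodup_inc v).filter _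

lemma length_keptAt_snd_le (B : Finset M.Edge) (v : Fin n) :
    (M.keptAt B v).2.length ≤ doublingConstant M.graph := by
  rw [keptAt, keepRow_snd]
  simp only [List.append_nil, List.length_reverse]
  exact (List.length_filter_le _ _).trans (M.length_inc_le v)

/-! ### Scores of components and exhaustive search. -/

lemma edgeScore_val (x : Fin n → S) (l : List M.Edge) (acc : ℝ) :
    (M.edgeScore x l acc).val =
      acc + (l.map fun e => M.edgePot e (x (M.lo e)) (x (M.hi e))).sum := by
  induction l generalizing acc with
  | nil => simp [edgeScore]
  | cons e l ih =>
    simp only [edgeScore, Timed.bind_val, List.map_cons, List.sum_cons]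
    rw [ih, add_assoc]

lemma edgeScore_time (x : Fin n → S) (l : List M.Edge) (acc : ℝ) :
    (M.edgeScore x l acc).time = 1 + 2 * l.length := by
  induction l generalizing acc with
  | nil => simp [edgeScore]
  | cons e l ih =>
    simp only [edgeScore, Timed.bind_time, tick_time, List.length_cons]
    rw [ih]
    ring

lemma score_val (low : Fin n → List M.Edge) (x : Fin n → S) (l : List (Fin n)) (acc : ℝ) :
    (M.score low x l acc).val = acc + (l.map fun v => M.nodePot v (x v) +
      ((low v).map fun e => M.edgePot e (x (M.lo e)) (x (M.hi e))).sum).sum := by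
  induction l generalizing acc with
  | nil => simp [score]
  | cons e l ih =>
    simp only [score, Timed.bind_val, List.map_cons, List.sum_cons]
    rw [ih, edgeScore_val]
    ring

lemma score_time_le (low : Fin n → List M.Edge) {d : ℕ} (hd : ∀ v, (low v).length ≤ d)
    (x : Fin n → S) (l : List (Fin n)) (acc : ℝ) :
    (M.score low x l acc).time ≤ 1 + l.length * (3 + 2 * d) := by
  induction l generalizing acc with
  | nil => simp [score]
  | cons e l ih =>
    simp only [score, Timed.bind_time, tick_time, List.length_cons, edgeScore_time]
    have h1 := ih (M.edgeScore x (low e) (acc + M.nodePot e (x e))).val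
    have h2 := hd e
    linarith

/-- A kept edge is listed only in the row of its smaller endpoint, so the rows count it once, under
the convention of `energyOn`. -/
lemma score_keptAt (B : Finset M.Edge) (c : (M.cutGraph B).ConnectedComponent)
    (comp : List (Fin n)) (hn : comp.Nodup)
    (hc : ∀ w, w ∈ comp ↔ (M.cutGraph B).connectedComponentMk w = c) (x : Fin n → S) :
    (M.score (fun w => (M.keptAt B w).2) x comp 0).val = M.energyOn B c x := by
  classical
  rw [score_val, zero_add, energyOn, ← List.sum_toFinset _ hn, Finset.sum_add_distrib]
  have h1 : comp.toFinset = Finset.univ.filter fun v => (M.cutGraph B).connectedComponentMk v = c := by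
    ext w
    simp [hc]
  rw [h1]
  congr 1
  rw [← Finset.sum_fiberwise_of_maps_to (g := M.lo)
    (t := Finset.univ.filter fun v => (M.cutGraph B).connectedComponentMk v = c)]
  · refine Finset.sum_congr rfl fun v hv => ?_
    rw [← List.sum_toFinset _ (M.nodup_keptAt_snd B v)]
    refine Finset.sum_congr ?_ fun _ _ => rfl
    ext e
    simp only [List.mem_toFinset, mem_keptAt_snd, Finset.mem_filter, Finset.mem_univ, true_and]
    simp only [Finset.mem_filter, Finset.mem_univ, true_and] at hv
    constructor
    · rintro ⟨h1, h2⟩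
      exact ⟨⟨h1, h2 ▸ hv⟩, h2⟩
    · tauto
  · intro e he
    simp only [Finset.mem_filter, Finset.mem_univ, true_and] at he ⊢
    exact he.2

/-- Both endpoints of a kept edge lie in one component. Hence changing values on one component does
not affect the others. -/
lemma energyOn_congr (B : Finset M.Edge) (c : (M.cutGraph B).ConnectedComponent)
    (x y : Fin n → S) (h : ∀ w, (M.cutGraph B).connectedComponentMk w = c → x w = y w) :
    M.energyOn B c x = M.energyOn B c y := by
  classical
  unfold energyOn
  congr 1
  · refine Finset.sum_congr rfl fun v hv => ?_
    rw [h v (by simpa using hv)]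
  · refine Finset.sum_congr rfl fun e he => ?_
    simp only [Finset.mem_filter, Finset.mem_univ, true_and] at he
    have hhi : (M.cutGraph B).connectedComponentMk (M.hi e) = c := by
      rw [← he.2, SimpleGraph.ConnectedComponent.eq]
      exact (M.cutGraph_adj_lo_hi B he.1).symm.reachable
    rw [h _ he.2, h _ hhi]

/-- Exhaustive search returns the best of the candidates. -/
lemma exhaust_spec (letters : List S) (hlet : ∀ a, a ∈ letters) (low : Fin n → List M.Edge)
    (comp : List (Fin n)) (x₀ : Fin n → S) (l : List (Fin n)) (hl : ∀ w ∈ l, w ∈ comp)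
    (x : Fin n → S) (best : ℝ × (Fin n → S)) (hx : ∀ w, w ∉ comp → x w = x₀ w)
    (hb : best.1 = (M.score low best.2 comp 0).val ∧ ∀ w, w ∉ comp → best.2 w = x₀ w) :
    ((M.exhaust letters low comp l x best).val.1 =
        (M.score low (M.exhaust letters low comp l x best).val.2 comp 0).val ∧
      ∀ w, w ∉ comp → (M.exhaust letters low comp l x best).val.2 w = x₀ w) ∧
    best.1 ≤ (M.exhaust letters low comp l x best).val.1 ∧
    ∀ y : Fin n → S, (∀ w, w ∉ l → y w = x w) →
      (M.score low y comp 0).val ≤ (M.exhaust letters low comp l x best).val.1 := by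
  induction l generalizing x best with
  | nil =>
    simp only [exhaust, Timed.bind_val]
    have hy : ∀ y : Fin n → S, (∀ w, w ∉ [] → y w = x w) → y = x := fun y hy =>
      funext fun w => hy w (by simp)
    split_ifs with h
    · refine ⟨⟨rfl, hx⟩, h.le, fun y hy' => ?_⟩
      rw [hy y hy']
      exact le_rfl
    · refine ⟨hb, le_rfl, fun y hy' => ?_⟩
      rw [hy y hy']
      exact not_lt.1 h
  | cons v l ih =>
    simp only [exhaust, Timed.bind_val]
    -- Induction on the letters still to be tried at `v`: the result beats those `y` whose value at
    -- `v` is among them.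
    have key : ∀ (ls : List S) (b : ℝ × (Fin n → S)),
        (b.1 = (M.score low b.2 comp 0).val ∧ ∀ w, w ∉ comp → b.2 w = x₀ w) →
        ∀ r, r = (ls.foldlM (fun b a => do
          tick 2
          M.exhaust letters low comp l (Function.update x v a) b) b).val →
        (r.1 = (M.score low r.2 comp 0).val ∧ ∀ w, w ∉ comp → r.2 w = x₀ w) ∧ b.1 ≤ r.1 ∧
        ∀ y : Fin n → S, y v ∈ ls → (∀ w, w ∉ v :: l → y w = x w) →
          (M.score low y comp 0).val ≤ r.1 := by
      intro ls
      induction ls with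
      | nil =>
        rintro b hb r rfl
        exact ⟨hb, le_rfl, by simp⟩
      | cons a ls ihl =>
        rintro b hb r rfl
        rw [List.foldlM_cons]
        simp only [Timed.bind_val]
        have hx' : ∀ w, w ∉ comp → Function.update x v a w = x₀ w := by
          intro w hw
          rw [Function.update_of_ne, hx w hw]
          rintro rfl
          exact hw (hl w (by simp))
        obtain ⟨h1, h2, h3⟩ := ih (fun w hw => hl w (List.mem_cons_of_mem _ hw))
          (Function.update x v a) b hx' hb
        obtain ⟨g1, g2, g3⟩ := ihl _ h1 _ rfl
        refine ⟨g1, h2.trans g2, fun y hy hyx => ?_⟩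
        rcases List.mem_cons.1 hy with hya | hy
        · refine (h3 y fun w hw => ?_).trans g2
          by_cases hwv : w = v
          · subst hwv
            rw [Function.update_self, hya]
          · rw [Function.update_of_ne hwv]
            exact hyx w (by simp [hwv, hw])
        · exact g3 y hy hyx
    obtain ⟨h1, h2, h3⟩ := key letters best hb _ rfl
    exact ⟨h1, h2, fun y hy => h3 y (hlet _) hy⟩

/-- The slack `5` closes the recursion: if a subtree satisfies `T + 5 ≤ A`, a branch costs `T + 2 ≤
A - 3`, and `1 + s * (A - 3) + 5 ≤ s * A` holds exactly when `s ≥ 2`. -/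
lemma exhaust_time_le (letters : List S) {s : ℕ} (hs : letters.length ≤ s) (h2 : 2 ≤ s)
    (low : Fin n → List M.Edge) {d : ℕ} (hd : ∀ v, (low v).length ≤ d) (comp : List (Fin n))
    (l : List (Fin n)) (x : Fin n → S) (best : ℝ × (Fin n → S)) :
    (M.exhaust letters low comp l x best).time + 5 ≤
      s ^ l.length * (8 + comp.length * (4 + 2 * d)) := by
  induction l generalizing x best with
  | nil =>
    simp only [exhaust, Timed.bind_time, tick_time, List.length_nil, pow_zero, one_mul]
    have := M.score_time_le low hd x comp 0
    split_ifs
    · simp only [Timed.bind_time, tick_time, Timed.pure_time]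
      linarith
    · simp only [Timed.pure_time]
      linarith
  | cons v l ih =>
    simp only [exhaust, Timed.bind_time, tick_time, List.length_cons]
    have key : ∀ (ls : List S) (b : ℝ × (Fin n → S)),
        (ls.foldlM (fun b a => do
          tick 2
          M.exhaust letters low comp l (Function.update x v a) b) b).time + 3 * ls.length ≤
          ls.length * (s ^ l.length * (8 + comp.length * (4 + 2 * d))) := by
      intro ls
      induction ls with
      | nil => simp
      | cons a ls ihl =>
        intro b
        rw [List.foldlM_cons]
        simp only [Timed.bind_time, Timed.bind_val, tick_time, List.length_cons]
        have h1 := ih (Function.update x v a) b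
        have h2 := ihl (M.exhaust letters low comp l (Function.update x v a) b).val
        linarith
    have h := key letters best
    have h8 : 8 ≤ s ^ l.length * (8 + comp.length * (4 + 2 * d)) := by
      have : 1 ≤ s ^ l.length := Nat.one_le_pow _ _ (by omega)
      nlinarith [Nat.zero_le (comp.length * (4 + 2 * d))]
    rw [pow_succ', mul_assoc]
    generalize s ^ l.length * (8 + comp.length * (4 + 2 * d)) = A at *
    have h4 : letters.length * (A - 3) ≤ s * (A - 3) := Nat.mul_le_mul_right _ hs
    obtain ⟨A, rfl⟩ := Nat.exists_eq_add_of_le' (show 3 ≤ A by omega)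
    simp only [Nat.add_sub_cancel] at h4
    nlinarith

/-- The bound on the time spent on one component in `solve`. -/
def componentCost (d m s : ℕ) : ℕ :=
  3 + (3 * m + (5 + 3 * d) * m + m * (3 + 2 * d)) + s ^ m * (8 + m * (4 + 2 * d))

open Classical in
-- The invariant: `seen` is a union of components, and `x` is already optimal on each of them.
-- Optimality and time share one induction since both rest on the same description of the component
-- found. The bound `s` on the alphabet may exceed its size, so that `2 ≤ s` also allows a single
-- letter.
lemma solve_spec (letters : List S) (hlet : ∀ a, a ∈ letters) (B : Finset M.Edge)
    (l : List (Fin n)) (seen : Finset (Fin n)) (x : Fin n → S)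
    (hcl : ∀ v ∈ seen, ∀ w, (M.cutGraph B).Adj v w → w ∈ seen)
    (hopt : ∀ v ∈ seen, ∀ y, M.energyOn B ((M.cutGraph B).connectedComponentMk v) y ≤
      M.energyOn B ((M.cutGraph B).connectedComponentMk v) x) :
    (∀ v, v ∈ seen ∨ v ∈ l → ∀ y, M.energyOn B ((M.cutGraph B).connectedComponentMk v) y ≤
      M.energyOn B ((M.cutGraph B).connectedComponentMk v)
        (M.solve letters (M.keptAt B) l seen x).val) ∧
    ∀ (m s : ℕ), letters.length ≤ s → 2 ≤ s →
      (∀ v, (Finset.univ.filter fun w => (M.cutGraph B).connectedComponentMk w =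
        (M.cutGraph B).connectedComponentMk v).card ≤ m) →
      (M.solve letters (M.keptAt B) l seen x).time ≤
        1 + l.length * (3 + componentCost (doublingConstant M.graph) m s) := by
  induction l generalizing seen x with
  | nil =>
    refine ⟨?_, ?_⟩
    · intro v hv
      simpa [solve] using hopt v (by simpa using hv)
    · intros
      simp [solve]
  | cons v l ih =>
    simp only [solve, Timed.bind_val, Timed.bind_time, tick_time, List.length_cons]
    split_ifs with hv
    · obtain ⟨h1, h2⟩ := ih seen x hcl hopt
      refine ⟨?_, ?_⟩
      · rintro w (hw | hw)
        · exact h1 w (Or.inl hw)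
        · rcases List.mem_cons.1 hw with rfl | hw
          · exact h1 w (Or.inl hv)
          · exact h1 w (Or.inr hw)
      · intro m s hs hs2 hm
        have := h2 m s hs hs2 hm
        have h0 := Nat.zero_le (componentCost (doublingConstant M.graph) m s)
        linarith
    · simp only [Timed.bind_val, Timed.bind_time, tick_time]
      obtain ⟨g1, g2, g3, g4, g5, g6⟩ := explore_spec (M.cutGraph B) (fun w => (M.keptAt B w).1)
        (M.mem_keptAt_fst B) (M.length_keptAt_fst_le B) seen v n [v] (insert v seen) []
        (fun w => by simp [or_comm])
        (fun w hw => by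
          have : w = v := by simpa using hw
          subst this
          exact ⟨hv, SimpleGraph.Reachable.refl _⟩)
        (by simp) (by simp) (by simp)
      set r := explore (fun w => (M.keptAt B w).1) n [v] (insert v seen) [] with hr
      -- A neighbour seen earlier would force `w` itself into the closed set `seen`.
      have hclosed : ∀ w ∈ r.val.2, ∀ z, (M.cutGraph B).Adj w z → z ∈ r.val.2 := by
        intro w hw z hz
        refine ((g1 z).1 (g4 w hw z hz)).resolve_left fun h => ?_
        exact (g3 w hw).1 (hcl z h w hz.symm)
      have hwalk : ∀ a b, (M.cutGraph B).Walk a b → a ∈ r.val.2 → b ∈ r.val.2 := by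
        intro a b p
        induction p with
        | nil => exact id
        | cons hab _ ihp => exact fun ha => ihp (hclosed _ ha _ hab)
      have hcomp : ∀ w, w ∈ r.val.2 ↔ (M.cutGraph B).connectedComponentMk w =
          (M.cutGraph B).connectedComponentMk v := by
        intro w
        rw [SimpleGraph.ConnectedComponent.eq]
        constructor
        · exact fun hw => (g3 w hw).2.symm
        · rintro ⟨p⟩
          exact hwalk _ _ p.reverse (g5 v (by simp))
      obtain ⟨⟨e1, e2⟩, -, e4⟩ := M.exhaust_spec letters hlet (fun w => (M.keptAt B w).2) r.val.2 x
        r.val.2 (fun _ h => h) x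
        ((M.score (fun w => (M.keptAt B w).2) x r.val.2 0).val, x) (fun _ _ => rfl)
        ⟨rfl, fun _ _ => rfl⟩
      set best := M.exhaust letters (fun w => (M.keptAt B w).2) r.val.2 r.val.2 x
        ((M.score (fun w => (M.keptAt B w).2) x r.val.2 0).val, x) with hbest
      have hsc := M.score_keptAt B _ r.val.2 g2 hcomp
      have hnew : ∀ y, M.energyOn B ((M.cutGraph B).connectedComponentMk v) y ≤
          M.energyOn B ((M.cutGraph B).connectedComponentMk v) best.val.2 := by
        intro y
        classical
        -- The search compares only assignments that agree with `x` off the component, so `y` is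
        -- modified there; its energy on the component does not change.
        have h := e4 (fun w => if w ∈ r.val.2 then y w else x w) (fun w hw => by simp [hw])
        rw [e1, hsc, hsc] at h
        refine le_trans (le_of_eq (M.energyOn_congr B _ _ _ fun w hw => ?_)) h
        simp [(hcomp w).2 hw]
      have hcl' : ∀ w ∈ r.val.1, ∀ z, (M.cutGraph B).Adj w z → z ∈ r.val.1 := by
        intro w hw z hz
        rw [g1] at hw ⊢
        rcases hw with hw | hw
        · exact Or.inl (hcl w hw z hz)
        · exact Or.inr (hclosed w hw z hz)
      have hopt' : ∀ w ∈ r.val.1, ∀ y, M.energyOn B ((M.cutGraph B).connectedComponentMk w) y ≤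
          M.energyOn B ((M.cutGraph B).connectedComponentMk w) best.val.2 := by
        intro w hw y
        rcases (g1 w).1 hw with hw | hw
        -- An old component is disjoint from the new one, where alone the assignment has changed:
        -- otherwise `v` would be reachable from `seen`.
        · refine (hopt w hw y).trans (le_of_eq (M.energyOn_congr B _ _ _ fun z hz => ?_))
          refine (e2 z fun hz' => hv ?_).symm
          rw [SimpleGraph.ConnectedComponent.eq] at hz
          have hwz := (hcomp z).1 hz'
          rw [SimpleGraph.ConnectedComponent.eq] at hwz
          obtain ⟨p⟩ := hz.symm.trans hwz
          have hwalk' : ∀ a b, (M.cutGraph B).Walk a b → a ∈ seen → b ∈ seen := by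
            intro a b p
            induction p with
            | nil => exact id
            | cons hab _ ihp => exact fun ha => ihp (hcl _ ha _ hab)
          exact hwalk' _ _ p hw
        · rw [(hcomp w).1 hw]
          exact hnew y
      obtain ⟨h1, h2⟩ := ih r.val.1 best.val.2 hcl' hopt'
      refine ⟨?_, ?_⟩
      · rintro w (hw | hw)
        · exact h1 w (Or.inl ((g1 w).2 (Or.inl hw)))
        · rcases List.mem_cons.1 hw with rfl | hw
          · exact h1 w (Or.inl ((g1 w).2 (Or.inr (g5 w (by simp)))))
          · exact h1 w (Or.inr hw)
      · intro m s hs hs2 hm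
        have ht := h2 m s hs hs2 hm
        have hlen : r.val.2.length ≤ m := by
          refine le_trans ?_ (hm v)
          rw [← List.toFinset_card_of_nodup g2]
          refine Finset.card_le_card fun w hw => ?_
          simpa [hcomp] using hw
        have hex := M.exhaust_time_le letters hs hs2 (fun w => (M.keptAt B w).2)
          (M.length_keptAt_snd_le B) r.val.2 r.val.2 x
          ((M.score (fun w => (M.keptAt B w).2) x r.val.2 0).val, x)
        have hscore := M.score_time_le (fun w => (M.keptAt B w).2)
          (M.length_keptAt_snd_le B) x r.val.2 0
        rw [← hbest] at hex
        have hpow : s ^ r.val.2.length * (8 + r.val.2.length * (4 + 2 * doublingConstant M.graph))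
            ≤ s ^ m * (8 + m * (4 + 2 * doublingConstant M.graph)) := by
          gcongr
          omega
        have hm1 := Nat.mul_le_mul_left (5 + 3 * doublingConstant M.graph) hlen
        have hm2 := Nat.mul_le_mul_right (3 + 2 * doublingConstant M.graph) hlen
        simp only [List.length_nil, mul_zero, add_zero] at g6
        have hcost : componentCost (doublingConstant M.graph) m s =
            3 + (3 * m + (5 + 3 * doublingConstant M.graph) * m +
              m * (3 + 2 * doublingConstant M.graph)) +
            s ^ m * (8 + m * (4 + 2 * doublingConstant M.graph)) := rfl
        generalize componentCost (doublingConstant M.graph) m s = Z at *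
        have hZ : 3 + r.time + 3 * r.val.2.length +
          (M.score (fun w => (M.keptAt B w).2) x r.val.2 0).time + best.time ≤ 3 + Z := by
          linarith
        linarith

/-- The components left by the decomposition have bounded radius. -/
lemma exists_edist_le_of_reachable {p : ℝ} (hp : p ∈ Set.Icc (0 : ℝ) 1) (K : ℕ)
    (B : Finset M.Edge) (hB : B ∈ (dbDim M.graph.lineGraph p hp K).support) (v : Fin n) :
    ∃ a, ∀ w, (M.cutGraph B).Reachable v w → M.graph.edist a w ≤ K := by
  obtain ⟨c, h1, h2⟩ := exists_center_of_mem_support M.graph.lineGraph _ K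
    (fun q hq => le_of_mem_support_stopLaw hp hq) _ _ B hB
  by_cases hv : ∃ e : M.Edge, e ∉ B ∧ v ∈ e.1
  · obtain ⟨e, he, hve⟩ := hv
    have hshare : ∀ f g : M.Edge, f ∉ B → g ∉ B → ∀ u, u ∈ f.1 → u ∈ g.1 → c f = c g := by
      intro f g hf hg u huf hug
      rcases eq_or_ne f g with rfl | hne
      · rfl
      · exact h2 f (Finset.mem_univ _) g (Finset.mem_univ _) hf hg
          (SimpleGraph.lineGraph_adj_iff_exists.2 ⟨hne, u, huf, hug⟩)
    -- Uncut edges sharing a vertex have the same centre, so the centre of `e` propagates along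
    -- walks.
    have hwalk : ∀ u w, (M.cutGraph B).Walk u w → (∃ f : M.Edge, f ∉ B ∧ u ∈ f.1 ∧ c f = c e) →
        ∃ f : M.Edge, f ∉ B ∧ w ∈ f.1 ∧ c f = c e := by
      intro u w q
      induction q with
      | nil => exact id
      | cons hadj _ ih =>
        rintro ⟨f, hf, huf, hfe⟩
        obtain ⟨g, hg, hgeq⟩ := (M.cutGraph_adj B _ _).1 hadj
        refine ih ⟨g, hg, by simp [hgeq], ?_⟩
        rw [← hfe]
        exact hshare g f hg hf _ (by simp [hgeq]) huf
    refine ⟨(Quot.out (c e).1).1, ?_⟩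
    rintro w ⟨q⟩
    obtain ⟨f, hf, hwf, hfe⟩ := hwalk v w q ⟨e, he, hve, rfl⟩
    have hlt := h1 f (Finset.mem_univ _) hf
    rw [hfe] at hlt
    -- The strict bound leaves distance at most `K - 1` in the graph of edges; the last unit is
    -- needed to pass to the other endpoint of `f`.
    cases K with
    | zero => simp at hlt
    | succ K =>
      have hle : M.graph.lineGraph.edist (c e) f ≤ K := by
        push_cast at hlt
        exact Order.lt_add_one_iff_of_not_isMax (by simp) |>.1 hlt
      obtain ⟨y, hy, hd⟩ := exists_mem_edist_le_of_lineGraph M.graph (c e)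
        (Sym2.out_fst_mem (c e).1) K f hle
      exact edist_le_succ_of_mem_edge M.graph hd f hy hwf
  -- Without an uncut edge at `v`, its component is `v` alone.
  · refine ⟨v, ?_⟩
    rintro w ⟨q⟩
    cases q with
    | nil => simp
    | cons hadj _ =>
      obtain ⟨g, hg, hgeq⟩ := (M.cutGraph_adj B _ _).1 hadj
      exact absurd ⟨g, hg, by simp [hgeq]⟩ hv

open Classical in
lemma card_component_le {p : ℝ} (hp : p ∈ Set.Icc (0 : ℝ) 1) (K : ℕ)
    (B : Finset M.Edge) (hB : B ∈ (dbDim M.graph.lineGraph p hp K).support) (v : Fin n) :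
    (Finset.univ.filter fun w => (M.cutGraph B).connectedComponentMk w =
        (M.cutGraph B).connectedComponentMk v).card ≤
      doublingConstant M.graph ^ (Nat.log 2 K + 1) := by
  obtain ⟨a, ha⟩ := M.exists_edist_le_of_reachable hp K B hB v
  refine (Finset.card_le_card fun w hw => ?_).trans (card_edist_le_le M.graph K a)
  simp only [Finset.mem_filter, Finset.mem_univ, true_and, SimpleGraph.ConnectedComponent.eq]
    at hw ⊢
  exact ha w hw.symm

/-! ### The whole algorithm: law of the output and step count. -/

section Run

variable [Fintype S] [Nonempty S]

/-- The assignment computed by the second phase of the algorithm. -/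
noncomputable def assembled (B : Finset M.Edge) : Fin n → S :=
  (M.solve Finset.univ.toList (M.keptAt B) (List.finRange n) ∅ fun _ => Classical.arbitrary S).val

lemma modeRun_map_val (p : ℝ) (hp : p ∈ Set.Icc (0 : ℝ) 1) (K : ℕ) :
    (M.modeRun p hp K).map Timed.val =
      (dbDim M.graph.lineGraph p hp K).map fun B => (B, M.assembled B) := by
  rw [modeRun, map_val_andThen, decompRun_map_val, ← PMF.bind_pure_comp]
  congr 1
  funext B
  rw [PMF.pure_map]
  simp only [Timed.bind_val, Timed.pure_val, Function.comp]
  rw [M.keepTable_val B _ _ (fun v hv => absurd (List.mem_finRange v) hv)]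
  rfl

lemma isComponentMAP_assembled (B : Finset M.Edge) : M.IsComponentMAP B (M.assembled B) := by
  intro c y
  induction c using SimpleGraph.ConnectedComponent.ind with
  | _ v =>
    exact (M.solve_spec Finset.univ.toList (by simp) B (List.finRange n) ∅
      (fun _ => Classical.arbitrary S) (by simp) (by simp)).1 v (Or.inr (List.mem_finRange v)) y

lemma isModeLaw_modeRun (p : ℝ) (hp : p ∈ Set.Icc (0 : ℝ) 1) (K : ℕ) :
    M.IsModeLaw p hp K ((M.modeRun p hp K).map Timed.val) := by
  rw [modeRun_map_val]
  refine ⟨?_, ?_⟩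
  · rw [PMF.map_comp]
    exact PMF.map_id _
  · intro z hz
    obtain ⟨B, -, rfl⟩ := (PMF.mem_support_map_iff _ _ _).1 hz
    exact M.isComponentMAP_assembled B

lemma modeRun_time_le (p : ℝ) (hp : p ∈ Set.Icc (0 : ℝ) 1) (K s : ℕ) (hs : Fintype.card S ≤ s)
    (hs2 : 2 ≤ s) (r : Timed (Finset M.Edge × (Fin n → S)))
    (hr : r ∈ (M.modeRun p hp K).support) :
    r.time ≤ 6 + Fintype.card M.Edge * (4 * K + 14 + 4 * doublingConstant M.graph +
      (5 + 6 * doublingConstant M.graph) *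
        (doublingConstant M.graph ^ (Nat.log 2 K + 1) * doublingConstant M.graph)) +
      n * (9 + 4 * doublingConstant M.graph + componentCost (doublingConstant M.graph)
        (doublingConstant M.graph ^ (Nat.log 2 K + 1)) s) := by
  rw [modeRun, mem_support_andThen] at hr
  obtain ⟨t, ht, y, hy, rfl⟩ := hr
  rw [PMF.mem_support_pure_iff] at hy
  subst hy
  have h1 := M.decompRun_time_le p hp K t ht
  have hB : t.val ∈ (dbDim M.graph.lineGraph p hp K).support := by
    rw [← decompRun_map_val]
    exact (PMF.mem_support_map_iff _ _ _).2 ⟨t, ht, rfl⟩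
  have h2 := M.keepTable_time_le t.val (List.finRange n) fun _ => ([], [])
  have h3 := (M.solve_spec Finset.univ.toList (by simp) t.val (List.finRange n) ∅
      (fun _ => Classical.arbitrary S) (by simp) (by simp)).2 _ s
      (by rwa [Finset.length_toList, Finset.card_univ]) hs2 (M.card_component_le hp K t.val hB)
  simp only [Timed.bind_time, Timed.pure_time, tick_time,
    M.keepTable_val t.val _ _ (fun v hv => absurd (List.mem_finRange v) hv)]
  rw [List.length_finRange] at h2 h3
  linarith

/-- All polynomial factors go into the exponent by `a ≤ s ^ a`. The constants are `33` for the
decomposition, `60` for the search and `6` for the rest. -/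
lemma modeRun_time_le_mul (p : ℝ) (hp : p ∈ Set.Icc (0 : ℝ) 1) (K s : ℕ)
    (hs : Fintype.card S ≤ s) (hs2 : 2 ≤ s) (hK : 1 ≤ K) (hn : 0 < n)
    (r : Timed (Finset M.Edge × (Fin n → S))) (hr : r ∈ (M.modeRun p hp K).support) :
    r.time ≤ 100 * (n * doublingConstant M.graph) * s ^ (K + 2 * doublingConstant M.graph +
      2 * doublingConstant M.graph ^ (Nat.log 2 K + 1)) := by
  refine (M.modeRun_time_le p hp K s hs hs2 r hr).trans ?_
  have : Nonempty (Fin n) := ⟨⟨0, hn⟩⟩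
  have hE := card_edgeSet_le M.graph
  rw [Fintype.card_fin] at hE
  have hl := one_le_doublingConstant M.graph
  have hm : 1 ≤ doublingConstant M.graph ^ (Nat.log 2 K + 1) := Nat.one_le_pow _ _ hl
  have hE' : Fintype.card M.Edge ≤ n * doublingConstant M.graph := by convert hE
  generalize Fintype.card M.Edge = E at *
  generalize doublingConstant M.graph ^ (Nat.log 2 K + 1) = m at *
  generalize doublingConstant M.graph = l at *
  have hlt : ∀ a : ℕ, a ≤ s ^ a := fun a => (Nat.lt_pow_self (by omega)).le
  have hbound : K * (l * l) * m * s ^ m ≤ s ^ (K + 2 * l + 2 * m) := by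
    rw [pow_add, pow_add, two_mul, two_mul, pow_add, pow_add, mul_assoc]
    gcongr <;> exact hlt _
  have hsm : 1 ≤ s ^ m := Nat.one_le_pow _ _ (by omega)
  have hll : l ≤ l * l := Nat.le_mul_self l
  have h1 : E * (4 * K + 14 + 4 * l + (5 + 6 * l) * (m * l)) ≤
      33 * (n * l) * (K * (l * l) * m * s ^ m) := by
    have e1 : 1 ≤ l * l := by nlinarith
    have e2 : 1 ≤ l * l * m := Nat.mul_pos e1 hm
    have e3 : K ≤ K * (l * l * m) := Nat.le_mul_of_pos_right _ e2
    have e4 : l * l * m ≤ K * (l * l * m) := Nat.le_mul_of_pos_left _ hK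
    have e5 : l * l ≤ l * l * m := Nat.le_mul_of_pos_right _ hm
    have e6 : l * m ≤ l * l * m := Nat.mul_le_mul_right _ hll
    have e7 : 4 * K + 14 + 4 * l + (5 + 6 * l) * (m * l) ≤ 33 * (K * (l * l * m)) := by
      have : (5 + 6 * l) * (m * l) = 5 * (l * m) + 6 * (l * l * m) := by ring
      linarith
    calc E * (4 * K + 14 + 4 * l + (5 + 6 * l) * (m * l))
        ≤ n * l * (33 * (K * (l * l * m))) := Nat.mul_le_mul hE' e7
      _ = 33 * (n * l) * (K * (l * l) * m * 1) := by ring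
      _ ≤ _ := by gcongr
  have h2 : n * (9 + 4 * l + componentCost l m s) ≤
      60 * (n * l) * (K * (l * l) * m * s ^ m) := by
    have e1 : 1 ≤ l * m := Nat.mul_pos hl hm
    have e2 : l ≤ l * m := Nat.le_mul_of_pos_right _ hm
    have e3 : m ≤ l * m := Nat.le_mul_of_pos_left _ hl
    have e4 : 9 + 4 * l + componentCost l m s ≤ 60 * (l * m) * s ^ m := by
      have f1 : componentCost l m s ≤ 3 + 11 * m + 5 * (l * m) + s ^ m * (14 * (l * m)) := by
        have : s ^ m * (8 + m * (4 + 2 * l)) ≤ s ^ m * (14 * (l * m)) := by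
          gcongr
          linarith
        unfold componentCost
        linarith
      have f2 : 9 + 4 * l + (3 + 11 * m + 5 * (l * m)) ≤ 32 * (l * m) * s ^ m := by
        have : 32 * (l * m) * 1 ≤ 32 * (l * m) * s ^ m := by gcongr
        linarith
      linarith
    calc n * (9 + 4 * l + componentCost l m s) ≤ n * (60 * (l * m) * s ^ m) := by gcongr
      _ = 60 * (n * l) * (1 * (1 * 1) * m * s ^ m) := by ring
      _ ≤ _ := by gcongr
  have h3 : 6 ≤ 6 * (n * l) * (K * (l * l) * m * s ^ m) := by
    have : 1 ≤ (n * l) * (K * (l * l) * m * s ^ m) := by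
      have : 0 < n * l * (K * (l * l) * m * s ^ m) := by positivity
      exact this
    linarith
  calc _ ≤ 100 * (n * l) * (K * (l * l) * m * s ^ m) := by linarith
    _ ≤ _ := by gcongr

end Run

/-! ### The loss of energy -/

/-- Vertices are grouped by component, and uncut edges by the component of their smaller endpoint.
-/
lemma energy_eq (B : Finset M.Edge) [Fintype (M.cutGraph B).ConnectedComponent] (x : Fin n → S) :
    M.energy x = ∑ c, M.energyOn B c x +
      ∑ e ∈ B, M.edgePot e (x (M.lo e)) (x (M.hi e)) := by
  classical
  unfold energyOn energy
  rw [Finset.sum_add_distrib, add_assoc]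
  congr 1
  · exact (Finset.sum_fiberwise _ _ _).symm
  · rw [← Finset.sum_filter_add_sum_filter_not Finset.univ (· ∈ B), add_comm]
    congr 1
    · rw [← Finset.sum_fiberwise _ fun e => (M.cutGraph B).connectedComponentMk (M.lo e)]
      refine Finset.sum_congr rfl fun c _ => Finset.sum_congr ?_ fun _ _ => rfl
      ext e
      simp
    · exact Finset.sum_congr (by ext; simp) fun _ _ => rfl

/-- On each component `x` is at least as good as `xs`, and the cut edges contribute nonnegatively to
the energy of `x`. -/
lemma energy_sub_le (B : Finset M.Edge) (x xs : Fin n → S) (hx : M.IsComponentMAP B x) :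
    M.energy xs - M.energy x ≤ ∑ e ∈ B, M.edgePot e (xs (M.lo e)) (xs (M.hi e)) := by
  have : Fintype (M.cutGraph B).ConnectedComponent := Fintype.ofFinite _
  rw [M.energy_eq B, M.energy_eq B x]
  have h1 : ∑ c, M.energyOn B c xs ≤ ∑ c, M.energyOn B c x :=
    Finset.sum_le_sum fun c _ => hx c xs
  have h2 : 0 ≤ ∑ e ∈ B, M.edgePot e (x (M.lo e)) (x (M.hi e)) :=
    Finset.sum_nonneg fun e _ => M.edgePot_nonneg _ _ _
  linarith

/-- The weights in `energy_sub_le` depend on the fixed `xs` and not on the output. So linearity of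
expectation needs only the marginal law of the cut, however ties are broken. -/
lemma expected_loss_le [Fintype S] {p : ℝ} (hp : p ∈ Set.Icc (0 : ℝ) 1) (K : ℕ) {ε : ℝ}
    (hε : 0 ≤ ε) (hcut : ∀ e : M.Edge,
      (dbDim M.graph.lineGraph p hp K).toOuterMeasure {B | e ∈ B} ≤ ENNReal.ofReal ε)
    (μ : PMF (Finset M.Edge × (Fin n → S))) (hμ : M.IsModeLaw p hp K μ) (xs : Fin n → S) :
    ∑ z, (μ z).toReal * (M.energy xs - M.energy z.2) ≤ ε * M.energy xs := by
  classical
  have hprob : ∀ e : M.Edge, ∑ z, (μ z).toReal * (if e ∈ z.1 then 1 else 0) ≤ ε := by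
    intro e
    have h := hcut e
    rw [← hμ.1, PMF.toOuterMeasure_map_apply, PMF.toOuterMeasure_apply_fintype] at h
    have h' := ENNReal.toReal_le_of_le_ofReal hε h
    rw [ENNReal.toReal_sum] at h'
    · refine le_trans (le_of_eq (Finset.sum_congr rfl fun z _ => ?_)) h'
      by_cases hz : e ∈ z.1
      · simp [hz]
      · simp [hz]
    · intro z _
      by_cases hz : e ∈ z.1
      · simpa [hz] using μ.apply_ne_top z
      · simp [hz]
  calc ∑ z, (μ z).toReal * (M.energy xs - M.energy z.2)
      ≤ ∑ z, (μ z).toReal * ∑ e ∈ z.1, M.edgePot e (xs (M.lo e)) (xs (M.hi e)) := by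
        refine Finset.sum_le_sum fun z _ => ?_
        by_cases hz : z ∈ μ.support
        · gcongr
          exact M.energy_sub_le z.1 z.2 xs (hμ.2 z hz)
        · rw [PMF.mem_support_iff, not_not] at hz
          simp [hz]
    _ = ∑ e : M.Edge, M.edgePot e (xs (M.lo e)) (xs (M.hi e)) *
          ∑ z, (μ z).toReal * (if e ∈ z.1 then 1 else 0) := by
        simp only [Finset.mul_sum]
        rw [Finset.sum_comm]
        refine Finset.sum_congr rfl fun z _ => ?_
        have h : ∀ e ∈ Finset.univ, M.edgePot e (xs (M.lo e)) (xs (M.hi e)) *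
            ((μ z).toReal * (if e ∈ z.1 then 1 else 0)) = if e ∈ z.1 then
              (μ z).toReal * M.edgePot e (xs (M.lo e)) (xs (M.hi e)) else 0 := by
          intro e _
          split_ifs <;> ring
        rw [Finset.sum_congr rfl h, Finset.sum_ite_mem, Finset.univ_inter]
    _ ≤ ∑ e : M.Edge, M.edgePot e (xs (M.lo e)) (xs (M.hi e)) * ε :=
        Finset.sum_le_sum fun e _ => mul_le_mul_of_nonneg_left (hprob e) (M.edgePot_nonneg _ _ _)
    _ ≤ ε * M.energy xs := by
        rw [← Finset.sum_mul, mul_comm]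
        refine mul_le_mul_of_nonneg_left ?_ hε
        exact le_add_of_nonneg_left (Finset.sum_nonneg fun v _ => M.nodePot_nonneg _ _)

/-- The probability that an edge is removed. -/
lemma dbDim_mem_le {p : ℝ} (hp : p ∈ Set.Icc (0 : ℝ) 1) {K : ℕ} (hK : 1 ≤ K) (e : M.Edge) :
    (dbDim M.graph.lineGraph p hp K).toOuterMeasure {B | e ∈ B} ≤
      ENNReal.ofReal (p + (1 - p) ^ (K - 1) *
        (doublingConstant M.graph ^ (Nat.log 2 K + 1) * doublingConstant M.graph : ℕ)) := by
  classical
  have h := dbDimFrom_mem_le M.graph.lineGraph (stopLaw p hp K) K (ENNReal.ofReal p)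
    (stopLaw_zero hp hK) (fun q hq => stopLaw_of_lt hp hq)
    (fun j h1 h2 => stopLaw_le_mul_tail hp h1 h2) Finset.univ ∅ e (Finset.mem_univ _) (by simp)
  refine h.trans ?_
  have h1p : 0 ≤ 1 - p := sub_nonneg.2 hp.2
  rw [ENNReal.ofReal_add hp.1 (by positivity), ENNReal.ofReal_mul (by positivity),
    stopLaw_self, ENNReal.ofReal_natCast]
  gcongr
  refine le_trans (Finset.card_le_card fun f hf => ?_)
    (card_lineGraph_edist_le_le M.graph K e)
  simp only [Finset.mem_filter, Finset.mem_univ, true_and] at hf ⊢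
  rw [SimpleGraph.edist_comm, hf]

end MRF

/-! ### Estimates for the parameters -/

lemma rate_pos {ε ρ : ℝ} (h0 : 0 < ε) : 0 < rate ε ρ := by
  unfold rate
  positivity

lemma rate_le {ε ρ : ℝ} (h0 : 0 < ε) (hρ : 1 ≤ ρ) : rate ε ρ ≤ ε / 16 := by
  have h : (2 : ℝ) ^ (-ρ - 3) ≤ (2 : ℝ) ^ (-4 : ℝ) :=
    Real.rpow_le_rpow_of_exponent_le (by norm_num) (by linarith)
  have h4 : (2 : ℝ) ^ (-4 : ℝ) = 1 / 16 := by
    rw [Real.rpow_neg (by norm_num), show (4 : ℝ) = ((4 : ℕ) : ℝ) by norm_num,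
      Real.rpow_natCast]
    norm_num
  unfold rate
  rw [h4] at h
  nlinarith

lemma log_rate {ε ρ : ℝ} (h0 : 0 < ε) :
    Real.log (rate ε ρ) = -(Real.log (1 / ε) + (ρ + 3) * Real.log 2) := by
  unfold rate
  rw [Real.log_mul h0.ne' (by positivity), Real.log_rpow (by norm_num), one_div, Real.log_inv]
  ring

lemma le_div_of_le {φ ρ : ℝ} (h0 : 0 < φ) (h1 : φ ≤ 1 / 16) (hρ : 1 ≤ ρ) :
    384 ≤ 24 * ρ / φ := by
  rw [le_div_iff₀ h0]
  nlinarith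

lemma one_le_log_div {φ ρ : ℝ} (h0 : 0 < φ) (h1 : φ ≤ 1 / 16) (hρ : 1 ≤ ρ) :
    1 ≤ Real.log (24 * ρ / φ) := by
  have h := le_div_of_le h0 h1 hρ
  rw [Real.le_log_iff_exp_le (by linarith)]
  linarith [Real.exp_one_lt_d9]

lemma le_radius {φ ρ : ℝ} (h0 : 0 < φ) (h1 : φ ≤ 1 / 16) (hρ : 1 ≤ ρ) : 192 ≤ radius φ ρ := by
  have h := le_div_of_le h0 h1 hρ
  have hl := one_le_log_div h0 h1 hρ
  have : radius φ ρ = 24 * ρ / φ / 2 * Real.log (24 * ρ / φ) := by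
    unfold radius
    ring
  rw [this]
  nlinarith

lemma two_mul_radius_le {φ ρ : ℝ} (h0 : 0 < φ) (h1 : φ ≤ 1 / 16) (hρ : 1 ≤ ρ) :
    2 * radius φ ρ ≤ (24 * ρ / φ) ^ 2 := by
  have h := le_div_of_le h0 h1 hρ
  have : 2 * radius φ ρ = 24 * ρ / φ * Real.log (24 * ρ / φ) := by
    unfold radius
    ring
  rw [this, sq]
  gcongr
  exact Real.log_le_self (by linarith)

lemma one_le_ceil_radius {φ ρ : ℝ} (h0 : 0 < φ) (h1 : φ ≤ 1 / 16) (hρ : 1 ≤ ρ) :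
    1 ≤ ⌈radius φ ρ⌉₊ :=
  Nat.one_le_ceil_iff.2 (by linarith [le_radius h0 h1 hρ])

lemma ceil_radius_le {φ ρ : ℝ} (h0 : 0 < φ) (h1 : φ ≤ 1 / 16) (hρ : 1 ≤ ρ) :
    (⌈radius φ ρ⌉₊ : ℝ) ≤ 2 * radius φ ρ := by
  have h := le_radius h0 h1 hρ
  have := Nat.ceil_lt_add_one (show 0 ≤ radius φ ρ by linarith)
  linarith

lemma doublingConstant_le_rpow {V : Type*} [Fintype V] [Nonempty V] (G : SimpleGraph V) {ρ : ℝ}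
    (h : doublingDim G ≤ ρ) : (doublingConstant G : ℝ) ≤ 2 ^ ρ := by
  have h1 : (0 : ℝ) < doublingConstant G := by exact_mod_cast one_le_doublingConstant G
  exact (Real.logb_le_iff_le_rpow (by norm_num) h1).1 h

/-- With `k = log₂ K + 1`, the power is at most `(2 ^ ρ) ^ k = (2 ^ k) ^ ρ`, and `2 ^ k ≤ 2 * K`. -/
lemma doublingConstant_pow_le {V : Type*} [Fintype V] [Nonempty V] (G : SimpleGraph V) {ρ : ℝ}
    (hρ : 1 ≤ ρ) (h : doublingDim G ≤ ρ) {K : ℕ} (hK : 1 ≤ K) :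
    ((doublingConstant G ^ (Nat.log 2 K + 1) : ℕ) : ℝ) ≤ (2 * K) ^ ρ := by
  have h1 := doublingConstant_le_rpow G h
  have h2 : ((2 ^ (Nat.log 2 K + 1) : ℕ) : ℝ) ≤ 2 * K := by
    have := Nat.pow_log_le_self 2 (show K ≠ 0 by omega)
    rw [pow_succ, mul_comm]
    exact_mod_cast Nat.mul_le_mul_left 2 this
  calc ((doublingConstant G ^ (Nat.log 2 K + 1) : ℕ) : ℝ)
      ≤ ((2 : ℝ) ^ ρ) ^ (Nat.log 2 K + 1) := by
        push_cast
        gcongr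
    _ = ((2 ^ (Nat.log 2 K + 1) : ℕ) : ℝ) ^ ρ := by
        rw [← Real.rpow_natCast, ← Real.rpow_mul (by norm_num), mul_comm,
          Real.rpow_mul (by norm_num), Real.rpow_natCast]
        push_cast
        rfl
    _ ≤ _ := by gcongr

/-- Put `L = 24 * ρ / φ`. The count of edges is at most `(4 * K) ^ ρ ≤ L ^ (3 * ρ)`, while `φ * R =
12 * ρ * log L` makes the power of `1 - φ` about `L ^ (-12 * ρ)`. The product is at most `1 / L = φ
/ (24 * ρ)`. -/
lemma cut_probability_le {V : Type*} [Fintype V] [Nonempty V] (G : SimpleGraph V) {φ ρ : ℝ}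
    (h0 : 0 < φ) (h1 : φ ≤ 1 / 16) (hρ : 1 ≤ ρ) (h : doublingDim G ≤ ρ) :
    (1 - φ) ^ (⌈radius φ ρ⌉₊ - 1) *
      (doublingConstant G ^ (Nat.log 2 ⌈radius φ ρ⌉₊ + 1) * doublingConstant G : ℕ) ≤ φ := by
  have hK := one_le_ceil_radius h0 h1 hρ
  have hK2 := ceil_radius_le h0 h1 hρ
  have hR2 := two_mul_radius_le h0 h1 hρ
  have hceil := Nat.le_ceil (radius φ ρ)
  have hL := le_div_of_le h0 h1 hρ
  have hlog := one_le_log_div h0 h1 hρ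
  have hrad : φ * radius φ ρ = 12 * ρ * Real.log (24 * ρ / φ) := by
    unfold radius
    field_simp
  have hφ : φ = 24 * ρ * Real.exp (-Real.log (24 * ρ / φ)) := by
    rw [Real.exp_neg, Real.exp_log (by linarith)]
    field_simp
  have hM := doublingConstant_pow_le G hρ h hK
  have hl := doublingConstant_le_rpow G h
  generalize ⌈radius φ ρ⌉₊ = K at *
  have hKpos : (1 : ℝ) ≤ K := by exact_mod_cast hK
  generalize radius φ ρ = R at *
  -- From `K ≤ 2 * R ≤ L ^ 2` and `4 ≤ 384 ≤ L`.
  have h4K : (4 : ℝ) * K ≤ (24 * ρ / φ) ^ 3 := by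
    have : (4 : ℝ) * K ≤ 384 * (24 * ρ / φ) ^ 2 := by linarith [sq_nonneg (24 * ρ / φ)]
    refine this.trans ?_
    rw [pow_succ _ 2, mul_comm]
    gcongr
  generalize 24 * ρ / φ = L at *
  have hexp : (1 - φ) ^ (K - 1) ≤ Real.exp (-(φ * (K - 1))) := by
    have : 1 - φ ≤ Real.exp (-φ) := by linarith [Real.add_one_le_exp (-φ)]
    calc (1 - φ) ^ (K - 1) ≤ Real.exp (-φ) ^ (K - 1) := by
          gcongr
          linarith
      _ = _ := by
          rw [← Real.exp_nat_mul]
          congr 1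
          push_cast [hK]
          ring
  have hN : ((doublingConstant G ^ (Nat.log 2 K + 1) * doublingConstant G : ℕ) : ℝ) ≤
      Real.exp (3 * ρ * Real.log L) := by
    rw [Nat.cast_mul]
    calc _ ≤ (2 * (K : ℝ)) ^ ρ * 2 ^ ρ := by gcongr
      _ = (4 * (K : ℝ)) ^ ρ := by
          rw [← Real.mul_rpow (by positivity) (by norm_num)]
          ring_nf
      _ ≤ (L ^ 3) ^ ρ := by gcongr
      _ = _ := by
          rw [Real.rpow_def_of_pos (by positivity), Real.log_pow]
          congr 1
          push_cast
          ring
  have hmul : (1 - φ) ^ (K - 1) *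
      ((doublingConstant G ^ (Nat.log 2 K + 1) * doublingConstant G : ℕ) : ℝ) ≤
      Real.exp (-(φ * (K - 1))) * Real.exp (3 * ρ * Real.log L) := by
    have : 0 ≤ 1 - φ := by linarith
    gcongr
  refine hmul.trans ?_
  rw [← Real.exp_add, hφ]
  -- Of the `12 * ρ * log L` available, `3 * ρ * log L` pays for the count; the rest covers `log L`
  -- and the `φ` lost to the exponent `K - 1`.
  have hle : -(φ * (K - 1)) + 3 * ρ * Real.log L ≤ -Real.log L := by
    nlinarith [mul_le_mul_of_nonneg_left hceil h0.le, mul_le_mul hρ hlog zero_le_one (by linarith)]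
  rw [← hφ]
  calc _ ≤ Real.exp (-Real.log L) := Real.exp_le_exp.2 hle
    _ ≤ 24 * ρ * Real.exp (-Real.log L) := by
        refine le_mul_of_one_le_left (Real.exp_pos _).le ?_
        linarith
    _ = φ := hφ.symm

/-! ### Guarantees at the chosen parameters. -/

namespace MRF

variable {n : ℕ} {S : Type} (M : MRF n S)

/-- Each of `K`, `λ` and `λ ^ (log₂ K + 1)` is at most `(4 * R) ^ ρ`, so the exponent is at most `5
* (4 * R) ^ ρ ≤ (20 * R) ^ ρ`, and `20 ≤ R`. -/
lemma modeRun_time_le_rpow [Fintype S] [Nonempty S] {ρ ε : ℝ} (hρ : 1 ≤ ρ) (h0 : 0 < ε)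
    (h1 : ε < 1) (hn : 0 < n) (h : doublingDim M.graph ≤ ρ) (s : ℕ) (hs : Fintype.card S ≤ s)
    (hs2 : 2 ≤ s) (r : Timed (Finset M.Edge × (Fin n → S)))
    (hr : r ∈ (M.modeRun (rate ε ρ) (rate_mem h0 h1 hρ) ⌈radius (rate ε ρ) ρ⌉₊).support) :
    (r.time : ℝ) ≤ 100 * (n * (2 : ℝ) ^ ρ * (s : ℝ) ^ (radius (rate ε ρ) ρ ^ (2 * ρ))) := by
  have : Nonempty (Fin n) := ⟨⟨0, hn⟩⟩
  have hφ0 : 0 < rate ε ρ := rate_pos h0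
  have hφ1 : rate ε ρ ≤ 1 / 16 := (rate_le h0 hρ).trans (by linarith)
  have hK := one_le_ceil_radius hφ0 hφ1 hρ
  have hK2 := ceil_radius_le hφ0 hφ1 hρ
  have hR := le_radius hφ0 hφ1 hρ
  have ht := M.modeRun_time_le_mul _ _ _ s hs hs2 hK hn r hr
  have hM := doublingConstant_pow_le M.graph hρ h hK
  have hl := doublingConstant_le_rpow M.graph h
  generalize ⌈radius (rate ε ρ) ρ⌉₊ = K at *
  generalize radius (rate ε ρ) ρ = R at *
  generalize hm : doublingConstant M.graph ^ (Nat.log 2 K + 1) = m at *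
  generalize doublingConstant M.graph = l at *
  have hs1 : (1 : ℝ) ≤ s := by exact_mod_cast (by omega : 1 ≤ s)
  have hexp : ((K + 2 * l + 2 * m : ℕ) : ℝ) ≤ R ^ (2 * ρ) := by
    have e1 : (K : ℝ) ≤ (4 * R) ^ ρ := by
      calc (K : ℝ) ≤ 4 * R := by linarith
        _ = (4 * R) ^ (1 : ℝ) := (Real.rpow_one _).symm
        _ ≤ (4 * R) ^ ρ := Real.rpow_le_rpow_of_exponent_le (by linarith) hρ
    have e2 : (l : ℝ) ≤ (4 * R) ^ ρ := hl.trans (by gcongr; linarith)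
    have e3 : (m : ℝ) ≤ (4 * R) ^ ρ := hM.trans (by gcongr ?_ ^ ρ; linarith)
    have e4 : (5 : ℝ) ≤ 5 ^ ρ := by
      calc (5 : ℝ) = 5 ^ (1 : ℝ) := (Real.rpow_one _).symm
        _ ≤ 5 ^ ρ := Real.rpow_le_rpow_of_exponent_le (by norm_num) hρ
    push_cast
    calc (K : ℝ) + 2 * l + 2 * m ≤ 5 * (4 * R) ^ ρ := by linarith
      _ ≤ 5 ^ ρ * (4 * R) ^ ρ := by gcongr
      _ = (5 * (4 * R)) ^ ρ := (Real.mul_rpow (by norm_num) (by linarith)).symm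
      _ ≤ (R ^ 2) ^ ρ := by
          gcongr
          nlinarith
      _ = R ^ (2 * ρ) := by
          rw [← Real.rpow_natCast, ← Real.rpow_mul (by linarith)]
          norm_num
  calc (r.time : ℝ) ≤ ((100 * (n * l) * s ^ (K + 2 * l + 2 * m) : ℕ) : ℝ) := by exact_mod_cast ht
    _ = 100 * (n * l * (s : ℝ) ^ ((K + 2 * l + 2 * m : ℕ) : ℝ)) := by
        rw [Real.rpow_natCast]
        push_cast
        ring
    _ ≤ _ := by gcongr

lemma expected_loss_le_of_doublingDim_le [Fintype S] {ρ ε : ℝ} (hρ : 1 ≤ ρ) (h0 : 0 < ε)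
    (h1 : ε < 1) (hn : 0 < n) (h : doublingDim M.graph ≤ ρ)
    (μ : PMF (Finset M.Edge × (Fin n → S)))
    (hμ : M.IsModeLaw (rate ε ρ) (rate_mem h0 h1 hρ) ⌈radius (rate ε ρ) ρ⌉₊ μ) (xs : Fin n → S) :
    ∑ z, (μ z).toReal * (M.energy xs - M.energy z.2) ≤ ε * M.energy xs := by
  have : Nonempty (Fin n) := ⟨⟨0, hn⟩⟩
  have hφ0 : 0 < rate ε ρ := rate_pos h0
  have hφε := rate_le h0 hρ
  have hφ1 : rate ε ρ ≤ 1 / 16 := hφε.trans (by linarith)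
  refine M.expected_loss_le _ _ h0.le (fun e => ?_) μ hμ xs
  refine (M.dbDim_mem_le _ (one_le_ceil_radius hφ0 hφ1 hρ) e).trans (ENNReal.ofReal_le_ofReal ?_)
  -- Both terms of the cut probability are at most `φ ≤ ε / 16`.
  have := cut_probability_le M.graph hφ0 hφ1 hρ h
  linarith

end MRF

/-! ### Almost linear time when the parameters grow slowly. -/

/-- The constant is `36 = 2 * 2 * 9`: the exponent `2 * ρ`, then `log R ≤ 2 * log L`, then `log L ≤
9 * (ρ + log (1 / ε))`. -/
lemma radius_rpow_le {ρ ε : ℝ} (hρ : 1 ≤ ρ) (h0 : 0 < ε) (h1 : ε < 1) :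
    radius (rate ε ρ) ρ ^ (2 * ρ) ≤ Real.exp (36 * (ρ * (ρ + Real.log (1 / ε)))) := by
  have hφ0 : 0 < rate ε ρ := rate_pos h0
  have hφ1 : rate ε ρ ≤ 1 / 16 := (rate_le h0 hρ).trans (by linarith)
  have hR := le_radius hφ0 hφ1 hρ
  have hR2 := two_mul_radius_le hφ0 hφ1 hρ
  have hL := le_div_of_le hφ0 hφ1 hρ
  have hε : 0 ≤ Real.log (1 / ε) := Real.log_nonneg (by rw [le_div_iff₀ h0]; linarith)
  have hlogL : Real.log (24 * ρ / rate ε ρ) ≤ 9 * (ρ + Real.log (1 / ε)) := by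
    rw [Real.log_div (by positivity) hφ0.ne', Real.log_mul (by norm_num) (by positivity),
      log_rate h0]
    have e1 : Real.log 24 ≤ 5 * Real.log 2 := by
      rw [show (5 : ℝ) * Real.log 2 = ((5 : ℕ) : ℝ) * Real.log 2 by norm_num, ← Real.log_pow]
      exact Real.log_le_log (by norm_num) (by norm_num)
    have e2 : Real.log ρ ≤ ρ - 1 := Real.log_le_sub_one_of_pos (by linarith)
    have e3 : Real.log 2 < 0.7 := lt_trans Real.log_two_lt_d9 (by norm_num)
    nlinarith
  have hlogR : Real.log (radius (rate ε ρ) ρ) ≤ 2 * Real.log (24 * ρ / rate ε ρ) := by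
    have : Real.log ((24 * ρ / rate ε ρ) ^ 2) = 2 * Real.log (24 * ρ / rate ε ρ) := by
      rw [Real.log_pow]
      norm_num
    rw [← this]
    exact Real.log_le_log (by linarith) (by linarith)
  rw [Real.rpow_def_of_pos (by linarith)]
  refine Real.exp_le_exp.2 ?_
  nlinarith

/-- With `y = √(log n)`, both exponents are eventually at most `y`, so the left side is at most `exp
(2 * y * log s)`, which loses against `n ^ δ = exp (δ * y ^ 2)`. -/
lemma eventually_rpow_mul_rpow_le {ι : Type*} {l : Filter ι} (n : ι → ℕ) (ρ ε : ι → ℝ)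
    (hρ : ∀ i, 1 ≤ ρ i) (h0 : ∀ i, 0 < ε i) (h1 : ∀ i, ε i < 1) (hn : Tendsto n l atTop)
    (ho : (fun i => ρ i * (ρ i + Real.log (1 / ε i))) =o[l] fun i => Real.log (Real.log (n i)))
    (s : ℝ) (hs : 2 ≤ s) {δ : ℝ} (hδ : 0 < δ) {c : ℝ} (hc : 0 < c) :
    ∀ᶠ i in l, (2 : ℝ) ^ ρ i * s ^ (radius (rate (ε i) (ρ i)) (ρ i) ^ (2 * ρ i)) ≤
      c * (n i : ℝ) ^ δ := by
  have hnR : Tendsto (fun i => (n i : ℝ)) l atTop := tendsto_natCast_atTop_atTop.comp hn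
  have hlog : Tendsto (fun i => Real.log (n i)) l atTop := Real.tendsto_log_atTop.comp hnR
  have hsqrt : Tendsto (fun i => √(Real.log (n i))) l atTop :=
    Real.tendsto_sqrt_atTop.comp hlog
  have hloglog : Tendsto (fun i => Real.log (Real.log (n i))) l atTop :=
    Real.tendsto_log_atTop.comp hlog
  -- The value `1 / 72` turns `exp (36 * τ)` into at most `(log n) ^ (1 / 2)`. The last threshold is
  -- what `2 * y * log s ≤ log c + δ * y ^ 2` requires once `y ≥ 1`.
  filter_upwards [ho.def (show (0 : ℝ) < 1 / 72 by norm_num), hloglog.eventually_ge_atTop 0,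
    hlog.eventually_ge_atTop 1, hnR.eventually_ge_atTop 1, hsqrt.eventually_ge_atTop 1,
    hsqrt.eventually_ge_atTop ((2 * Real.log s + |Real.log c|) / δ)] with i hi hll hl1 hn1 hq1 hq
  have hε : 0 ≤ Real.log (1 / ε i) :=
    Real.log_nonneg (by rw [le_div_iff₀ (h0 i)]; linarith [h1 i])
  have hρi := hρ i
  set τ := ρ i * (ρ i + Real.log (1 / ε i)) with hτ
  have hτρ : ρ i ≤ τ := by nlinarith
  rw [Real.norm_of_nonneg (by linarith), Real.norm_of_nonneg hll] at hi
  have hy : Real.exp (36 * τ) ≤ √(Real.log (n i)) := by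
    have hlpos : 0 < Real.log (n i) := by linarith
    calc Real.exp (36 * τ) ≤ Real.exp (Real.log (√(Real.log (n i)))) := by
          refine Real.exp_le_exp.2 ?_
          rw [Real.log_sqrt hlpos.le]
          linarith
      _ = _ := Real.exp_log (Real.sqrt_pos.2 hlpos)
  have hX := (radius_rpow_le hρi (h0 i) (h1 i)).trans hy
  have hρy : ρ i ≤ √(Real.log (n i)) := by
    have := Real.add_one_le_exp (36 * τ)
    linarith
  have hsq : √(Real.log (n i)) * √(Real.log (n i)) = Real.log (n i) :=
    Real.mul_self_sqrt (by linarith)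
  set y := √(Real.log (n i)) with hydef
  have hlogs : 0 ≤ Real.log s := Real.log_nonneg (by linarith)
  calc (2 : ℝ) ^ ρ i * s ^ (radius (rate (ε i) (ρ i)) (ρ i) ^ (2 * ρ i))
      ≤ s ^ y * s ^ y := by
        gcongr
        · exact (Real.rpow_le_rpow (by norm_num) hs (by linarith)).trans
            (Real.rpow_le_rpow_of_exponent_le (by linarith) hρy)
        · linarith
    _ = Real.exp (2 * Real.log s * y) := by
        rw [Real.rpow_def_of_pos (by linarith), ← Real.exp_add]
        ring_nf
    _ ≤ Real.exp (Real.log c + Real.log (n i) * δ) := by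
        refine Real.exp_le_exp.2 ?_
        rw [div_le_iff₀ hδ] at hq
        have e1 := neg_abs_le (Real.log c)
        have e2 : (2 * Real.log s + |Real.log c|) * y ≤ y * δ * y := by gcongr
        have e3 : |Real.log c| ≤ |Real.log c| * y := le_mul_of_one_le_right (abs_nonneg _) hq1
        rw [← hsq]
        nlinarith
    _ = c * (n i : ℝ) ^ δ := by
        rw [Real.exp_add, Real.exp_log hc, Real.rpow_def_of_pos (by linarith)]

end ModeAlg

open ModeAlg in
theorem mainTheorem3 :
    (∃ C : ℝ, ∀ (n : ℕ) (S : Type) [Fintype S] [Nonempty S] (M : MRF n S) (ρ ε : ℝ)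
        (hρ : 1 ≤ ρ) (h0 : 0 < ε) (h1 : ε < 1),
        0 < n → doublingDim M.graph ≤ ρ →
        (∀ μ : PMF (Finset M.Edge × (Fin n → S)),
          M.IsModeLaw (rate ε ρ) (rate_mem h0 h1 hρ) ⌈radius (rate ε ρ) ρ⌉₊ μ →
          ∀ xs : Fin n → S, M.IsMAP xs →
            ∑ z, (μ z).toReal * (M.energy xs - M.energy z.2) ≤ ε * M.energy xs) ∧
        M.IsModeLaw (rate ε ρ) (rate_mem h0 h1 hρ) ⌈radius (rate ε ρ) ρ⌉₊
          ((M.modeRun (rate ε ρ) (rate_mem h0 h1 hρ) ⌈radius (rate ε ρ) ρ⌉₊).map Timed.val) ∧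
        (2 ≤ Fintype.card S →
          ∀ r ∈ (M.modeRun (rate ε ρ) (rate_mem h0 h1 hρ) ⌈radius (rate ε ρ) ρ⌉₊).support,
            (r.time : ℝ) ≤
              C * (n * (2 : ℝ) ^ ρ * (Fintype.card S : ℝ) ^ (radius (rate ε ρ) ρ ^ (2 * ρ))))) ∧
    (∀ (S : Type) [Fintype S] [Nonempty S] (n : ℕ → ℕ) (M : ∀ i, MRF (n i) S) (ρ ε : ℕ → ℝ)
        (hρ : ∀ i, 1 ≤ ρ i) (h0 : ∀ i, 0 < ε i) (h1 : ∀ i, ε i < 1),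
        (∀ i, doublingDim (M i).graph ≤ ρ i) →
        Tendsto n atTop atTop →
        (fun i => ρ i * (ρ i + Real.log (1 / ε i))) =o[atTop]
          (fun i => Real.log (Real.log (n i))) →
        ∀ δ : ℝ, 0 < δ → ∀ c : ℝ, 0 < c → ∀ᶠ i in atTop,
          ∀ r ∈ ((M i).modeRun (rate (ε i) (ρ i)) (rate_mem (h0 i) (h1 i) (hρ i))
              ⌈radius (rate (ε i) (ρ i)) (ρ i)⌉₊).support,
            (r.time : ℝ) ≤ c * (n i : ℝ) ^ (1 + δ)) := by
  refine ⟨⟨100, fun n S _ _ M ρ ε hρ h0 h1 hn hd => ⟨fun μ hμ xs _ => ?_, ?_, ?_⟩⟩, ?_⟩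
  · exact M.expected_loss_le_of_doublingDim_le hρ h0 h1 hn hd μ hμ xs
  · exact M.isModeLaw_modeRun _ _ _
  · exact fun hS r hr => M.modeRun_time_le_rpow hρ h0 h1 hn hd _ le_rfl hS r hr
  · intro S _ _ n M ρ ε hρ h0 h1 hd hn ho δ hδ c hc
    -- The base `max (card S) 2` includes the one-letter alphabet, and `c / 100` cancels the
    -- constant of the time bound.
    filter_upwards [eventually_rpow_mul_rpow_le n ρ ε hρ h0 h1 hn ho
      ((max (Fintype.card S) 2 : ℕ) : ℝ) (by exact_mod_cast le_max_right _ _) hδ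
      (show 0 < c / 100 by positivity), hn.eventually_gt_atTop 0] with i hi hni r hr
    have ht := (M i).modeRun_time_le_rpow (hρ i) (h0 i) (h1 i) hni (hd i) _ (le_max_left _ 2)
      (le_max_right _ _) r hr
    have hpos : (0 : ℝ) < n i := by exact_mod_cast hni
    rw [Real.rpow_add hpos, Real.rpow_one]
    calc (r.time : ℝ) ≤ _ := ht
      _ = 100 * n i * (2 ^ ρ i * ((max (Fintype.card S) 2 : ℕ) : ℝ) ^
          (radius (rate (ε i) (ρ i)) (ρ i) ^ (2 * ρ i))) := by ring
      _ ≤ 100 * n i * (c / 100 * (n i : ℝ) ^ δ) := by gcongr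
      _ = c * (n i * (n i : ℝ) ^ δ) := by ring
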